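/- **Setting.** A two-layer ReLU network on $\mathbb R$ with $H$ hidden neurons computes $f(x)=\sum_{n=1}^H v_n\max\{0,u_nx+b_n\}+c$; its "norm" is $\big(\sum_n v_n^2+\sum_n u_n^2\big)^{1/2}$. For a finite labeled set $\mathcal L\subset\mathbb R\times\{\pm1\}$, the minimum-norm interpolator minimizes this norm among all such networks that satisfy $f(x_i)=y_i$ for all $(x_i,y_i)\in\mathcal L$ and are constant to the left of the leftmost and to the right of the rightmost labeled point. Among the minimizers one takes as $f_{\mathcal L}$ the function that is affine between neighboring labeled points; write $\|f_{\mathcal L}\|$ for the minimal norm. For an unlabeled point $w$ let $t(w)\in\{\pm1\}$ minimize $\|f_{\mathcal L\cup\{(w,t)\}}\|$ over $t$, and let $f^w=f_{\mathcal L\cup\{(w,t(w))\}}$. The two scores are $$\mathsf{score}_{\mathcal F}(w)=\|f^w\|,\qquad \mathsf{score}_{\mathtt D}(w)=\int_0^1|f^w(x)-f_{\mathcal L}(x)|^2\,dx .$$ MaxiMin active learning on a pool of $N$ points first labels the leftmost and the rightmost point; then it repeatedly labels an unlabeled point of largest score, chosen uniformly at random among the maximizers (and does nothing once all points are labeled).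 Its training error is zero when $\operatorname{sign} f_{\mathcal L}(x_i)=y_i$ for all $N$ points. **Statement.** For all constants $0<c_1\le c_2$ and $a>0$ there is a constant $C>0$, depending only on $c_1,c_2,a$, with the following property. Let $N\ge2$, $k\ge1$ and $H\ge N$, and let $g:[0,1]\to\{-1,+1\}$ be constant on (the interior of) each of $k$ consecutive intervals that partition $[0,1]$ and have lengths between $c_1/k$ and $c_2/k$. Let $x_1,\dots,x_N$ be independent and uniformly distributed on $[0,1]$ with labels $y_i=g(x_i)$. Run MaxiMin active learning with networks of $H$ hidden neurons and either of the two scores. Then for every integer $t\ge0$ with $t+2\ge C\,k\log N$, after the two initial labels and $t$ further steps (at most $t+2$ labels in total) the training error is zero with probability at least $1-N^{-a}$, over the points and the random tie-breaking. Thus $O(k\log N)$ labels suffice to label all $N$ points correctly. -/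

import Mathlib

open scoped ENNReal

noncomputable section

namespace MaxiMin

/-- Parameters of a two-layer ReLU network on the real line with `H` hidden neurons:
input weights `u`, output weights `v`, hidden biases `b`, output bias `c`. -/
structure ReLUNet (H : ℕ) where
  v : Fin H → ℝ
  u : Fin H → ℝ
  b : Fin H → ℝ
  c : ℝ

/-- The function `x ↦ ∑ₙ vₙ max(0, uₙ x + bₙ) + c` computed by the network. -/
def ReLUNet.eval {H : ℕ} (θ : ReLUNet H) (x : ℝ) : ℝ :=
  (∑ n, θ.v n * max 0 (θ.u n * x + θ.b n)) + θ.c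

/-- The "norm" of a network: the `ℓ²`-norm of its weights `(v, u)`; biases are not counted. -/
def ReLUNet.weightNorm {H : ℕ} (θ : ReLUNet H) : ℝ :=
  Real.sqrt ((∑ n, θ.v n ^ 2) + ∑ n, θ.u n ^ 2)

/-- `f` takes the prescribed value at each labeled point. A labeled set is a finite set of pairs
(point, label). -/
def Interpolates (f : ℝ → ℝ) (L : Finset (ℝ × ℝ)) : Prop :=
  ∀ p ∈ L, f p.1 = p.2

/-- `f` is constant to the left of the leftmost labeled point and to the right of the rightmost
labeled point. -/
def ConstantExtension (f : ℝ → ℝ) (L : Finset (ℝ × ℝ)) : Prop :=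
  (∀ p ∈ L, (∀ q ∈ L, p.1 ≤ q.1) → ∀ z ≤ p.1, f z = f p.1) ∧
    ∀ p ∈ L, (∀ q ∈ L, q.1 ≤ p.1) → ∀ z, p.1 ≤ z → f z = f p.1

/-- The networks over which the norm is minimized: they fit the labeled set and are forced to have
a constant extension to its left and right. -/
def ReLUNet.Fits {H : ℕ} (θ : ReLUNet H) (L : Finset (ℝ × ℝ)) : Prop :=
  Interpolates θ.eval L ∧ ConstantExtension θ.eval L

/-- The norm of the minimum "norm" interpolator of `L` (infinite if no network fits `L`). -/
def minNorm (H : ℕ) (L : Finset (ℝ × ℝ)) : ℝ≥0∞ :=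
  ⨅ (θ : ReLUNet H) (_ : θ.Fits L), ENNReal.ofReal θ.weightNorm

/-- `θ` solves the minimum "norm" interpolation problem for `L`. -/
def ReLUNet.IsMinNorm {H : ℕ} (θ : ReLUNet H) (L : Finset (ℝ × ℝ)) : Prop :=
  θ.Fits L ∧ ∀ θ' : ReLUNet H, θ'.Fits L → θ.weightNorm ≤ θ'.weightNorm

/-- `f` is linear (affine) between each pair of neighboring labeled points. -/
def LinearBetweenNeighbors (f : ℝ → ℝ) (L : Finset (ℝ × ℝ)) : Prop :=
  ∀ p ∈ L, ∀ q ∈ L, p.1 < q.1 → (∀ r ∈ L, ¬ (p.1 < r.1 ∧ r.1 < q.1)) →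
    ∃ α β : ℝ, ∀ z ∈ Set.Icc p.1 q.1, f z = α * z + β

open Classical in
/-- The function computed by a minimum "norm" interpolating network of `L`. Such networks may
compute different functions; as usual the one is taken that is linear between neighboring labeled
points, and this determines the function. (The value `0` is used only if there is none.) -/
def minNormFun (H : ℕ) (L : Finset (ℝ × ℝ)) : ℝ → ℝ :=
  if h : ∃ θ : ReLUNet H, θ.IsMinNorm L ∧ LinearBetweenNeighbors θ.eval L then
    (Classical.choose h).eval
  else fun _ => 0

open Classical in
/-- The estimated label of an unlabeled point `w`: the label in `{+1, -1}` with the smaller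
minimum norm. (In case of equality it is `+1`; the scores below do not depend on this.) -/
def estLabel (H : ℕ) (L : Finset (ℝ × ℝ)) (w : ℝ) : ℝ :=
  if minNorm H (insert (w, 1) L) ≤ minNorm H (insert (w, -1) L) then 1 else -1

/-- The labeled set after adding `w` with its estimated label. -/
def augment (H : ℕ) (L : Finset (ℝ × ℝ)) (w : ℝ) : Finset (ℝ × ℝ) :=
  open Classical in insert (w, estLabel H L w) L

/-- The two MaxiMin criteria. -/
inductive Criterion
  | functionNorm
  | dataNorm

/-- The score of an unlabeled point `w` given the labeled set `L`: the norm of the new minimum norm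
interpolator `f^w`, or the squared `L²` distance `∫ |f^w - f|² dP_X` to the current one, where
`P_X` is the uniform distribution on `[0,1]`. -/
def score (cr : Criterion) (H : ℕ) (L : Finset (ℝ × ℝ)) (w : ℝ) : ℝ≥0∞ :=
  match cr with
  | .functionNorm => minNorm H (augment H L w)
  | .dataNorm => ∫⁻ z in Set.Icc (0 : ℝ) 1,
      ENNReal.ofReal (|minNormFun H (augment H L w) z - minNormFun H L z| ^ 2)

/-- The labeled set given by the indices in `S`, when the points are `x i` and the true label of a
point is given by `g`. -/
def labeledData {N : ℕ} (g : ℝ → ℝ) (x : Fin N → ℝ) (S : Finset (Fin N)) : Finset (ℝ × ℝ) :=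
  open Classical in S.image fun i => (x i, g (x i))

open Classical in
/-- The unlabeled indices with the largest score. -/
def maximizers {N : ℕ} (cr : Criterion) (H : ℕ) (g : ℝ → ℝ) (x : Fin N → ℝ)
    (S : Finset (Fin N)) : Finset (Fin N) :=
  Finset.univ.filter fun i => i ∉ S ∧
    ∀ j, j ∉ S → score cr H (labeledData g x S) (x j) ≤ score cr H (labeledData g x S) (x i)

open Classical in
/-- The initially labeled examples: the leftmost and the rightmost point. -/
def initialSet {N : ℕ} (x : Fin N → ℝ) : Finset (Fin N) :=
  Finset.univ.filter fun i => (∀ j, x i ≤ x j) ∨ ∀ j, x j ≤ x i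

open Classical in
/-- One step of the algorithm: label an example of largest score, chosen uniformly at random among
the maximizers. If all examples are labeled, nothing happens. -/
def step {N : ℕ} (cr : Criterion) (H : ℕ) (g : ℝ → ℝ) (x : Fin N → ℝ)
    (S : Finset (Fin N)) : PMF (Finset (Fin N)) :=
  if h : (maximizers cr H g x S).Nonempty then
    (PMF.uniformOfFinset (maximizers cr H g x S) h).map fun i => insert i S
  else PMF.pure S

/-- The distribution of the set of labeled examples after `t` steps, for fixed points `x`. -/
def run {N : ℕ} (cr : Criterion) (H : ℕ) (g : ℝ → ℝ) (x : Fin N → ℝ) : ℕ → PMF (Finset (Fin N))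
  | 0 => PMF.pure (initialSet x)
  | t + 1 => (run cr H g x t).bind (step cr H g x)

/-- The sign of the interpolator of the labeled examples `S` is the true label at all `N` points. -/
def ZeroTrainingError {N : ℕ} (H : ℕ) (g : ℝ → ℝ) (x : Fin N → ℝ) (S : Finset (Fin N)) : Prop :=
  ∀ i, Real.sign (minNormFun H (labeledData g x S) (x i)) = g (x i)

/-- The probability that the training error is zero after `t` steps, when the `N` points are
independent and uniform on `[0,1]` and ties are broken at random. -/
def successProb (N : ℕ) (cr : Criterion) (H : ℕ) (g : ℝ → ℝ) (t : ℕ) : ℝ≥0∞ :=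
  ∫⁻ x : Fin N → ℝ, (run cr H g x t).toOuterMeasure {S | ZeroTrainingError H g x S}
    ∂(MeasureTheory.Measure.pi fun _ => MeasureTheory.volume.restrict (Set.Icc (0 : ℝ) 1))

/-- `g` is a `±1`-valued function on `[0,1]` that is constant on each of `k` consecutive pieces,
each of length between `c₁ / k` and `c₂ / k`. A breakpoint may belong to either adjacent piece. -/
def PiecewiseConstant (k : ℕ) (c₁ c₂ : ℝ) (g : ℝ → ℝ) : Prop :=
  (∀ z ∈ Set.Icc (0 : ℝ) 1, g z = 1 ∨ g z = -1) ∧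
    ∃ τ : ℕ → ℝ, τ 0 = 0 ∧ τ k = 1 ∧
      ∀ j < k, τ j < τ (j + 1) ∧ c₁ / k ≤ τ (j + 1) - τ j ∧ τ (j + 1) - τ j ≤ c₂ / k ∧
        ∃ s : ℝ, ∀ z ∈ Set.Ioo (τ j) (τ (j + 1)), g z = s

end MaxiMin

end

open scoped ENNReal

noncomputable section

namespace MaxiMin

/-! The minimum norm problem is solved explicitly. The piecewise linear interpolant of the labels
has slope changes `d p` at the labeled points, and at a `±1` label `d p` opposes the label, so the
energy `-∑ d p * y p` equals `∑ |d p|`. Testing an arbitrary fitting network against `d` bounds its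
squared norm below by twice this energy (`energy_le`). One balanced neuron per knot attains the
bound (`exists_net_of_isSpline`).

Labeling `w` inside a gap `(a, b)` adds a multiple of a tent function (`IsSpline.insert_knot`), so
both scores are explicit. If the ends of the gap share a label, `w` changes nothing and its score is
a base value (`score_of_same`). If the labels differ, the score exceeds the base value, and within
the gap it increases with the distance to the nearer end (`score_of_opp`, `oppScore_le_imp`,
`baseScore_lt_oppScore`). Hence, as long as some gap with opposite labels contains unlabeled points,
the algorithm labels a most central point of such a gap. Otherwise it samples uniformly from all
unlabeled points.

A central point need not halve its gap, since the pool may cluster near the ends. Still, the length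
of the gap times the spread of its unlabeled points shrinks by the factor `3/4` on either side
(`Pool.cost_left`, `Pool.cost_right`). In a `δ`-separated pool each gap thus admits `O(log δ⁻¹)`
bisections. There are at most `k` gaps with opposite labels, so a potential of size `O(k log δ⁻¹)`
falls by at least `1` per bisection and never rises. A uniform sample meets a piece not yet labeled
with probability at least `c` times the number of such pieces, when every piece has at least `c * N`
points.

Both mechanisms enter one Lyapunov function: the number of unlabeled pieces (plus `1/2` when a
bisection is pending) times the exponential of `μ` times the potential. Its expectation contracts by
`exp (-μ)` in every step, and Markov's inequality bounds the failure probability for a fixed pool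
(`Pool.le_toOuterMeasure_run`). A random pool is separated at a polynomially small scale and has
enough points in each piece, up to small probability (`pool_irregular`, `pool_sparse`). -/

/-! ### Piecewise linear interpolants. -/

/-- The continuous piecewise linear function with value `c` at `-∞` and slope change `d p` at each
knot `p ∈ X`. -/
def spl (X : Finset ℝ) (d : ℝ → ℝ) (c z : ℝ) : ℝ := c + ∑ p ∈ X, d p * max 0 (z - p)

/-- `spl X d c` interpolates `y` on `X` and has slope zero at `+∞`. -/
structure IsSpline (X : Finset ℝ) (y d : ℝ → ℝ) (c : ℝ) : Prop where
  interp : ∀ p ∈ X, spl X d c p = y p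
  sum_zero : ∑ p ∈ X, d p = 0

/-- `a < b` are consecutive elements of `X`. -/
def IsGap (X : Finset ℝ) (a b : ℝ) : Prop := a ∈ X ∧ b ∈ X ∧ a < b ∧ ∀ p ∈ X, p ≤ a ∨ b ≤ p

theorem spl_of_le {X : Finset ℝ} {d : ℝ → ℝ} {c z : ℝ} (h : ∀ p ∈ X, z ≤ p) :
    spl X d c z = c := by
  unfold spl
  rw [Finset.sum_eq_zero, add_zero]
  intro p hp
  rw [max_eq_left (by linarith [h p hp]), mul_zero]

theorem spl_of_ge {X : Finset ℝ} {d : ℝ → ℝ} {c z : ℝ} (hd : ∑ p ∈ X, d p = 0)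
    (h : ∀ p ∈ X, p ≤ z) : spl X d c z = c - ∑ p ∈ X, d p * p := by
  unfold spl
  have : ∑ p ∈ X, d p * max 0 (z - p) = (∑ p ∈ X, d p) * z - ∑ p ∈ X, d p * p := by
    rw [Finset.sum_mul, ← Finset.sum_sub_distrib]
    refine Finset.sum_congr rfl fun p hp => ?_
    rw [max_eq_right (by linarith [h p hp])]
    ring
  rw [this, hd]
  ring

theorem spl_affine {X : Finset ℝ} {d : ℝ → ℝ} {c a b : ℝ} (h : ∀ p ∈ X, p ≤ a ∨ b ≤ p) :
    ∃ α β : ℝ, ∀ z ∈ Set.Icc a b, spl X d c z = α * z + β := by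
  refine ⟨∑ p ∈ X, if p ≤ a then d p else 0, c - ∑ p ∈ X, if p ≤ a then d p * p else 0, ?_⟩
  rintro z ⟨hz₁, hz₂⟩
  unfold spl
  have : ∑ p ∈ X, d p * max 0 (z - p) = (∑ p ∈ X, if p ≤ a then d p else 0) * z
      - ∑ p ∈ X, if p ≤ a then d p * p else 0 := by
    rw [Finset.sum_mul, ← Finset.sum_sub_distrib]
    refine Finset.sum_congr rfl fun p hp => ?_
    split_ifs with hpa
    · rw [max_eq_right (by linarith)]
      ring
    · rw [max_eq_left (by rcases h p hp with h | h <;> [exact absurd h hpa; linarith])]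
      ring
  rw [this]
  ring

theorem eq_of_affine_on {f : ℝ → ℝ} {a b : ℝ} (hab : a < b)
    (h : ∃ α β : ℝ, ∀ z ∈ Set.Icc a b, f z = α * z + β) {z : ℝ} (hz : z ∈ Set.Icc a b) :
    f z = f a + (f b - f a) * ((z - a) / (b - a)) := by
  obtain ⟨α, β, h⟩ := h
  rw [h z hz, h a ⟨le_rfl, hab.le⟩, h b ⟨hab.le, le_rfl⟩]
  have : b - a ≠ 0 := by linarith
  field_simp
  ring

theorem IsSpline.eq_on_gap {X : Finset ℝ} {y d : ℝ → ℝ} {c a b : ℝ} (hs : IsSpline X y d c)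
    (h : IsGap X a b) {z : ℝ} (hz : z ∈ Set.Icc a b) :
    spl X d c z = y a + (y b - y a) * ((z - a) / (b - a)) := by
  rw [eq_of_affine_on h.2.2.1 (spl_affine h.2.2.2) hz, hs.interp a h.1, hs.interp b h.2.1]

theorem exists_isGap {X : Finset ℝ} {l r w : ℝ} (hl : l ∈ X) (hr : r ∈ X) (hlw : l < w)
    (hwr : w < r) (hw : w ∉ X) : ∃ a b, IsGap X a b ∧ a < w ∧ w < b := by
  have h₁ : (X.filter (· < w)).Nonempty := ⟨l, by simp [hl, hlw]⟩
  have h₂ : (X.filter (w < ·)).Nonempty := ⟨r, by simp [hr, hwr]⟩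
  have ha := Finset.max'_mem _ h₁
  have hb := Finset.min'_mem _ h₂
  rw [Finset.mem_filter] at ha hb
  refine ⟨_, _, ⟨ha.1, hb.1, ha.2.trans hb.2, fun p hp => ?_⟩, ha.2, hb.2⟩
  rcases lt_trichotomy p w with h | h | h
  · exact Or.inl (Finset.le_max' _ _ (by simp [hp, h]))
  · exact absurd (h ▸ hp) hw
  · exact Or.inr (Finset.min'_le _ _ (by simp [hp, h]))

/-- Any point is left of `X`, right of `X`, in `X`, or inside a gap of `X`. -/
theorem cases_position {X : Finset ℝ} (z : ℝ) :
    (∀ p ∈ X, z ≤ p) ∨ (∀ p ∈ X, p ≤ z) ∨ z ∈ X ∨ ∃ a b, IsGap X a b ∧ a < z ∧ z < b := by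
  by_cases h₁ : ∀ p ∈ X, z ≤ p
  · exact Or.inl h₁
  by_cases h₂ : ∀ p ∈ X, p ≤ z
  · exact Or.inr (Or.inl h₂)
  by_cases h₃ : z ∈ X
  · exact Or.inr (Or.inr (Or.inl h₃))
  push Not at h₁ h₂
  obtain ⟨l, hl, hlz⟩ := h₁
  obtain ⟨r, hr, hzr⟩ := h₂
  exact Or.inr (Or.inr (Or.inr (exists_isGap hl hr hlz hzr h₃)))

theorem IsSpline.const_left {X : Finset ℝ} {y d : ℝ → ℝ} {c p : ℝ} (hs : IsSpline X y d c)
    (hp : p ∈ X) (h : ∀ q ∈ X, p ≤ q) {z : ℝ} (hz : z ≤ p) : spl X d c z = y p := by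
  rw [spl_of_le fun q hq => hz.trans (h q hq), ← hs.interp p hp, spl_of_le h]

theorem IsSpline.const_right {X : Finset ℝ} {y d : ℝ → ℝ} {c p : ℝ} (hs : IsSpline X y d c)
    (hp : p ∈ X) (h : ∀ q ∈ X, q ≤ p) {z : ℝ} (hz : p ≤ z) : spl X d c z = y p := by
  rw [spl_of_ge hs.sum_zero fun q hq => (h q hq).trans hz, ← hs.interp p hp,
    spl_of_ge hs.sum_zero h]

/-- Between knots the values are convex combinations of neighboring labels, and outside they are
labels. This bound makes the spline a feasible dual certificate in `energy_le`. -/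
theorem IsSpline.abs_le_one {X : Finset ℝ} {y d : ℝ → ℝ} {c : ℝ} (hs : IsSpline X y d c)
    (hX : X.Nonempty) (hy : ∀ p ∈ X, |y p| ≤ 1) (z : ℝ) : |spl X d c z| ≤ 1 := by
  rcases cases_position (X := X) z with h | h | h | ⟨a, b, hg, haz, hzb⟩
  · have hm := X.min'_mem hX
    rw [hs.const_left hm (fun q hq => X.min'_le q hq) (h _ hm)]
    exact hy _ hm
  · have hm := X.max'_mem hX
    rw [hs.const_right hm (fun q hq => X.le_max' q hq) (h _ hm)]
    exact hy _ hm
  · rw [hs.interp z h]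
    exact hy z h
  · rw [hs.eq_on_gap hg ⟨haz.le, hzb.le⟩]
    have h1 := abs_le.1 (hy a hg.1)
    have h2 := abs_le.1 (hy b hg.2.1)
    have h3 : 0 ≤ (z - a) / (b - a) := div_nonneg (by linarith) (by linarith)
    have h4 : (z - a) / (b - a) ≤ 1 := (div_le_one (by linarith)).2 (by linarith)
    rw [abs_le]
    constructor <;> nlinarith

/-- Where the data are extremal, the slope change has the opposite sign. -/
theorem IsSpline.abs_coeff {X : Finset ℝ} {y d : ℝ → ℝ} {c : ℝ} (hs : IsSpline X y d c)
    (hy : ∀ p ∈ X, y p = 1 ∨ y p = -1) {p : ℝ} (hp : p ∈ X) : |d p| = -(d p * y p) := by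
  have hb := hs.abs_le_one ⟨p, hp⟩ (fun q hq => by rcases hy q hq with h | h <;> simp [h])
  obtain ⟨ε, hε, hsep⟩ : ∃ ε : ℝ, 0 < ε ∧ ∀ q ∈ X, q ≠ p → ε ≤ |p - q| := by
    by_cases hne : (X.erase p).Nonempty
    · obtain ⟨q, hq, hmin⟩ := Finset.exists_min_image (X.erase p) (fun q => |p - q|) hne
      refine ⟨|p - q|, abs_pos.2 (sub_ne_zero.2 (Finset.ne_of_mem_erase hq).symm), ?_⟩
      intro r hr hrp
      exact hmin r (Finset.mem_erase.2 ⟨hrp, hr⟩)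
    · refine ⟨1, one_pos, fun q hq hqp => ?_⟩
      exact absurd ⟨q, Finset.mem_erase.2 ⟨hqp, hq⟩⟩ hne
  -- No other knot lies within `ε` of `p`, so the second difference sees `d p` alone. Its sign is
  -- forced because the value at `p` is a global extremum.
  have key : spl X d c (p + ε) + spl X d c (p - ε) - 2 * spl X d c p = d p * ε := by
    unfold spl
    have : ∑ q ∈ X, d q * max 0 (p + ε - q) + ∑ q ∈ X, d q * max 0 (p - ε - q)
        - 2 * ∑ q ∈ X, d q * max 0 (p - q) = ∑ q ∈ X, if q = p then d p * ε else 0 := by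
      rw [Finset.mul_sum, ← Finset.sum_add_distrib, ← Finset.sum_sub_distrib]
      refine Finset.sum_congr rfl fun q hq => ?_
      split_ifs with hqp
      · subst hqp
        rw [max_eq_right (by linarith), max_eq_left (by linarith), max_eq_left (by linarith)]
        ring
      · have h := hsep q hq hqp
        rcases le_abs.1 h with h | h
        · rw [max_eq_right (by linarith), max_eq_right (by linarith),
            max_eq_right (by linarith)]
          ring
        · rw [max_eq_left (by linarith), max_eq_left (by linarith), max_eq_left (by linarith)]
          ring
    rw [Finset.sum_ite_eq' X p, if_pos hp] at this
    linarith
  rw [hs.interp p hp] at key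
  have h1 := abs_le.1 (hb (p + ε))
  have h2 := abs_le.1 (hb (p - ε))
  rcases hy p hp with h | h <;> rw [h] at key ⊢
  · have : d p ≤ 0 := by
      by_contra hd
      have := mul_pos (not_le.1 hd) hε
      linarith
    rw [abs_of_nonpos this]
    ring
  · have : 0 ≤ d p := by
      by_contra hd
      have := mul_neg_of_neg_of_pos (not_le.1 hd) hε
      linarith
    rw [abs_of_nonneg this]
    ring

/-! ### Tent functions and the insertion of a knot. -/

/-- The tent function with value `1` at `w`, supported on `[a, b]`. -/
def tent (a w b z : ℝ) : ℝ :=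
  (w - a)⁻¹ * max 0 (z - a) - ((w - a)⁻¹ + (b - w)⁻¹) * max 0 (z - w)
    + (b - w)⁻¹ * max 0 (z - b)

theorem tent_left {a w b z : ℝ} (haw : a < w) (hwb : w < b) (hz : z ≤ a) :
    tent a w b z = 0 := by
  unfold tent
  rw [max_eq_left (by linarith), max_eq_left (by linarith), max_eq_left (by linarith)]
  ring

theorem tent_right {a w b z : ℝ} (haw : a < w) (hwb : w < b) (hz : b ≤ z) :
    tent a w b z = 0 := by
  unfold tent
  rw [max_eq_right (by linarith), max_eq_right (by linarith), max_eq_right (by linarith)]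
  have : w - a ≠ 0 := by linarith
  have : b - w ≠ 0 := by linarith
  field_simp
  ring

theorem tent_mid_left {a w b z : ℝ} (hwb : w < b) (hz : a ≤ z) (hz' : z ≤ w) :
    tent a w b z = (w - a)⁻¹ * (z - a) := by
  unfold tent
  rw [max_eq_right (by linarith), max_eq_left (by linarith), max_eq_left (by linarith)]
  ring

theorem tent_mid_right {a w b z : ℝ} (haw : a < w) (hwb : w < b) (hz : w ≤ z) (hz' : z ≤ b) :
    tent a w b z = (b - w)⁻¹ * (b - z) := by
  unfold tent
  rw [max_eq_right (by linarith), max_eq_right (by linarith), max_eq_left (by linarith)]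
  have : w - a ≠ 0 := by linarith
  have : b - w ≠ 0 := by linarith
  field_simp
  ring

/-- The slope changes of `tent a w b`. -/
def tentCoeff (a w b p : ℝ) : ℝ :=
  if p = a then (w - a)⁻¹ else if p = w then -((w - a)⁻¹ + (b - w)⁻¹) else
    if p = b then (b - w)⁻¹ else 0

theorem sum_tentCoeff_mul {X : Finset ℝ} {a w b : ℝ} (ha : a ∈ X) (hw : w ∈ X) (hb : b ∈ X)
    (haw : a < w) (hwb : w < b) (φ : ℝ → ℝ) :
    ∑ p ∈ X, tentCoeff a w b p * φ p
      = (w - a)⁻¹ * φ a - ((w - a)⁻¹ + (b - w)⁻¹) * φ w + (b - w)⁻¹ * φ b := by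
  have h : ∀ p, tentCoeff a w b p * φ p = (if p = a then (w - a)⁻¹ * φ a else 0)
      + (if p = w then -((w - a)⁻¹ + (b - w)⁻¹) * φ w else 0)
      + (if p = b then (b - w)⁻¹ * φ b else 0) := by
    intro p
    unfold tentCoeff
    by_cases h1 : p = a
    · subst h1
      simp [haw.ne, (haw.trans hwb).ne]
    · by_cases h2 : p = w
      · subst h2
        simp [h1, hwb.ne]
      · by_cases h3 : p = b
        · subst h3
          simp [h1, h2]
        · simp [h1, h2, h3]
  simp_rw [h, Finset.sum_add_distrib, Finset.sum_ite_eq', if_pos ha, if_pos hw, if_pos hb]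
  ring

/-- Inserting a knot between neighbors adds a multiple of a tent function to the spline. -/
theorem IsSpline.insert_knot {X : Finset ℝ} {y d : ℝ → ℝ} {c a b w : ℝ} (hs : IsSpline X y d c)
    (hg : IsGap X a b) (haw : a < w) (hwb : w < b) (y' : ℝ → ℝ) (hy : ∀ p ∈ X, y' p = y p) :
    ∃ d' : ℝ → ℝ, IsSpline (insert w X) y' d' c ∧
      (∀ z, spl (insert w X) d' c z = spl X d c z
        + (y' w - spl X d c w) * tent a w b z) ∧
      -∑ p ∈ insert w X, d' p * y' p = -∑ p ∈ X, d p * y p + (y' w - spl X d c w) *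
        ((w - a)⁻¹ * (y' w - y a) + (b - w)⁻¹ * (y' w - y b)) := by
  have hw : w ∉ X := fun h => by rcases hg.2.2.2 w h with h | h <;> linarith
  set κ := y' w - spl X d c w with hκ
  -- Off `X` the values of `d` are arbitrary, so `d w` is erased before `w` becomes a knot.
  set d₀ : ℝ → ℝ := fun p => if p = w then 0 else d p with hd₀
  have hsum : ∀ φ : ℝ → ℝ, ∑ p ∈ insert w X, (d₀ p + κ * tentCoeff a w b p) * φ p
      = ∑ p ∈ X, d p * φ p + κ * ((w - a)⁻¹ * φ a - ((w - a)⁻¹ + (b - w)⁻¹) * φ w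
        + (b - w)⁻¹ * φ b) := by
    intro φ
    rw [← sum_tentCoeff_mul (X := insert w X) (by simp [hg.1]) (by simp) (by simp [hg.2.1])
      haw hwb φ, Finset.mul_sum]
    simp_rw [add_mul, Finset.sum_add_distrib]
    congr 1
    · rw [Finset.sum_insert hw]
      simp only [hd₀, if_true, zero_mul, zero_add]
      refine Finset.sum_congr rfl fun p hp => ?_
      rw [if_neg fun h : p = w => hw (h ▸ hp)]
    · refine Finset.sum_congr rfl fun p _ => by ring
  have hspl : ∀ z, spl (insert w X) (fun p => d₀ p + κ * tentCoeff a w b p) c z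
      = spl X d c z + κ * tent a w b z := by
    intro z
    unfold spl tent
    rw [hsum fun p => max 0 (z - p)]
    ring
  refine ⟨fun p => d₀ p + κ * tentCoeff a w b p, ⟨?_, ?_⟩, hspl, ?_⟩
  · intro p hp
    rw [hspl]
    rcases Finset.mem_insert.1 hp with rfl | hp
    · rw [tent_mid_left hwb haw.le le_rfl, inv_mul_cancel₀ (by linarith), hκ]
      ring
    · rw [hs.interp p hp, hy p hp]
      rcases hg.2.2.2 p hp with h | h
      · rw [tent_left haw hwb h]
        ring
      · rw [tent_right haw hwb h]
        ring
  · have := hsum fun _ => 1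
    simp only [mul_one] at this
    rw [this, hs.sum_zero]
    ring
  · rw [hsum, hy a hg.1, hy b hg.2.1, Finset.sum_congr rfl fun p hp => by rw [hy p hp]]
    ring

theorem isSpline_pair {l r : ℝ} (hlr : l < r) (y : ℝ → ℝ) :
    ∃ d, IsSpline {l, r} y d (y l) := by
  refine ⟨fun p => if p = l then (y r - y l) / (r - l) else -((y r - y l) / (r - l)), ?_, ?_⟩
  · intro p hp
    unfold spl
    rw [Finset.sum_pair hlr.ne]
    beta_reduce
    rw [if_pos rfl, if_neg hlr.ne']
    rcases Finset.mem_insert.1 hp with rfl | hp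
    · rw [max_eq_left (by linarith), max_eq_left (by linarith)]
      ring
    · rw [Finset.mem_singleton.1 hp, max_eq_right (by linarith), max_eq_left (by linarith)]
      have : r - l ≠ 0 := by linarith
      field_simp
      ring
  · rw [Finset.sum_pair hlr.ne]
    rw [if_pos rfl, if_neg hlr.ne']
    ring

/-- `X` contains two points `l < r` that enclose it. -/
def Enclosed (X : Finset ℝ) : Prop := ∃ l ∈ X, ∃ r ∈ X, l < r ∧ ∀ p ∈ X, l ≤ p ∧ p ≤ r

/-- Starting from the two extreme knots, every further point falls inside a gap and
`IsSpline.insert_knot` applies. -/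
theorem exists_isSpline {X : Finset ℝ} (hX : Enclosed X) (y : ℝ → ℝ) :
    ∃ d c, IsSpline X y d c := by
  obtain ⟨l, hl, r, hr, hlr, hX⟩ := hX
  suffices h : ∀ T : Finset ℝ, (∀ p ∈ T, l ≤ p ∧ p ≤ r) → ∃ d c, IsSpline (T ∪ {l, r}) y d c by
    have := h X hX
    rwa [Finset.union_eq_left.2 (by simp [Finset.insert_subset_iff, hl, hr])] at this
  intro T
  induction T using Finset.induction_on with
  | empty =>
    intro _
    obtain ⟨d, hd⟩ := isSpline_pair hlr y
    exact ⟨d, y l, by simpa using hd⟩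
  | insert w T hw ih =>
    intro hT
    obtain ⟨d, c, hs⟩ := ih fun p hp => hT p (Finset.mem_insert_of_mem hp)
    rw [Finset.insert_union]
    by_cases hmem : w ∈ T ∪ {l, r}
    · rw [Finset.insert_eq_of_mem hmem]
      exact ⟨d, c, hs⟩
    have hwlr := hT w (Finset.mem_insert_self _ _)
    have hwl : w ≠ l := fun h => hmem (by simp [h])
    have hwr : w ≠ r := fun h => hmem (by simp [h])
    obtain ⟨a, b, hg, haw, hwb⟩ := exists_isGap (X := T ∪ {l, r}) (l := l) (r := r) (by simp)
      (by simp) (lt_of_le_of_ne hwlr.1 hwl.symm) (lt_of_le_of_ne hwlr.2 hwr) hmem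
    obtain ⟨d', hd', -⟩ := hs.insert_knot hg haw hwb y fun _ _ => rfl
    exact ⟨d', c, hd'⟩

/-! ### Labeled sets and the networks that fit them. -/

/-- The labeled set with positions `X` and labels `y`. -/
def graph (X : Finset ℝ) (y : ℝ → ℝ) : Finset (ℝ × ℝ) := X.image fun z => (z, y z)

theorem mem_graph {X : Finset ℝ} {y : ℝ → ℝ} {p : ℝ × ℝ} :
    p ∈ graph X y ↔ p.1 ∈ X ∧ p.2 = y p.1 := by
  unfold graph
  rw [Finset.mem_image]
  constructor
  · rintro ⟨z, hz, rfl⟩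
    exact ⟨hz, rfl⟩
  · rintro ⟨h₁, h₂⟩
    exact ⟨p.1, h₁, by rw [← h₂]⟩

theorem mk_mem_graph {X : Finset ℝ} {y : ℝ → ℝ} {z : ℝ} (hz : z ∈ X) : (z, y z) ∈ graph X y :=
  mem_graph.2 ⟨hz, rfl⟩

theorem fits_of_isSpline {H : ℕ} {θ : ReLUNet H} {X : Finset ℝ} {y d : ℝ → ℝ} {c : ℝ}
    (hs : IsSpline X y d c) (hθ : ∀ z, θ.eval z = spl X d c z) : θ.Fits (graph X y) := by
  refine ⟨fun p hp => ?_, fun p hp h z hz => ?_, fun p hp h z hz => ?_⟩ <;>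
    obtain ⟨hp₁, hp₂⟩ := mem_graph.1 hp
  · rw [hθ, hs.interp _ hp₁, hp₂]
  · rw [hθ, hθ, hs.interp _ hp₁, hs.const_left hp₁ (fun q hq => h _ (mk_mem_graph hq)) hz]
  · rw [hθ, hθ, hs.interp _ hp₁, hs.const_right hp₁ (fun q hq => h _ (mk_mem_graph hq)) hz]

theorem linearBetween_of_isSpline {X : Finset ℝ} {y d : ℝ → ℝ} {c : ℝ} :
    LinearBetweenNeighbors (spl X d c) (graph X y) := by
  intro p hp q hq hpq h
  refine spl_affine fun r hr => ?_
  have := h (r, y r) (mk_mem_graph hr)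
  by_contra hc
  push Not at hc
  exact this hc

/-- Values at the knots, constancy outside and linearity in between leave no freedom. The choice
made in `minNormFun` is therefore harmless. -/
theorem eq_spl_of_fits {H : ℕ} {θ : ReLUNet H} {X : Finset ℝ} {y d : ℝ → ℝ} {c : ℝ}
    (hX : X.Nonempty) (hs : IsSpline X y d c) (hθ : θ.Fits (graph X y))
    (hl : LinearBetweenNeighbors θ.eval (graph X y)) : θ.eval = spl X d c := by
  have hint : ∀ p ∈ X, θ.eval p = y p := fun p hp => hθ.1 _ (mk_mem_graph hp)
  funext z
  rcases cases_position (X := X) z with h | h | h | ⟨a, b, hg, haz, hzb⟩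
  · have hm := X.min'_mem hX
    rw [hs.const_left hm (fun q hq => X.min'_le q hq) (h _ hm),
      hθ.2.1 _ (mk_mem_graph hm) (fun q hq => X.min'_le _ (mem_graph.1 hq).1) z (h _ hm)]
    exact hint _ hm
  · have hm := X.max'_mem hX
    rw [hs.const_right hm (fun q hq => X.le_max' q hq) (h _ hm),
      hθ.2.2 _ (mk_mem_graph hm) (fun q hq => X.le_max' _ (mem_graph.1 hq).1) z (h _ hm)]
    exact hint _ hm
  · rw [hint z h, hs.interp z h]
  · have hz : z ∈ Set.Icc a b := ⟨haz.le, hzb.le⟩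
    rw [hs.eq_on_gap hg hz, eq_of_affine_on hg.2.2.1
      (hl (a, y a) (mk_mem_graph hg.1) (b, y b) (mk_mem_graph hg.2.1) hg.2.2.1 ?_) hz,
      hint a hg.1, hint b hg.2.1]
    rintro r hr ⟨h₁, h₂⟩
    rcases hg.2.2.2 _ (mem_graph.1 hr).1 with h | h <;> simp only at h₁ h₂ <;> linarith

/-! ### The minimum norm by duality. -/

/-- A network that is constant near `+∞` has total slope zero there. -/
theorem slope_atTop {H : ℕ} {θ : ReLUNet H} {r : ℝ}
    (h : ∀ z, r ≤ z → θ.eval z = θ.eval r) :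
    ∑ n, (if 0 < θ.u n then θ.v n * θ.u n else 0) = 0 := by
  -- Far to the right each neuron is either linear or constant, so comparing the values at `z` and
  -- `z + 1` reads off the total slope.
  have hev : ∀ n, ∀ᶠ z in Filter.atTop, 0 ≤ z ∧ (0 < θ.u n → 0 ≤ θ.u n * z + θ.b n) ∧
      (θ.u n < 0 → θ.u n * (z + 1) + θ.b n ≤ 0 ∧ θ.u n * z + θ.b n ≤ 0) := by
    intro n
    filter_upwards [Filter.eventually_ge_atTop 0,
      Filter.eventually_ge_atTop (-θ.b n / θ.u n)] with z h0 hz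
    refine ⟨h0, fun hu => ?_, fun hu => ?_⟩
    · rw [div_le_iff₀ hu] at hz
      linarith
    · rw [div_le_iff_of_neg hu] at hz
      constructor <;> linarith
  obtain ⟨z, hz, hrz⟩ := ((Filter.eventually_all.2 hev).and
    (Filter.eventually_ge_atTop r)).exists
  have h0 : θ.eval (z + 1) - θ.eval z = 0 := by
    rw [h z hrz, h (z + 1) (by linarith), sub_self]
  refine Eq.trans ?_ h0
  unfold ReLUNet.eval
  rw [add_sub_add_right_eq_sub, ← Finset.sum_sub_distrib]
  refine Finset.sum_congr rfl fun n _ => ?_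
  obtain ⟨-, h₁, h₂⟩ := hz n
  split_ifs with hu
  · have := h₁ hu
    rw [max_eq_right (by linarith), max_eq_right this]
    ring
  · rcases (not_lt.1 hu).lt_or_eq with hu | hu
    · obtain ⟨h3, h4⟩ := h₂ hu
      rw [max_eq_left h3, max_eq_left h4]
      ring
    · rw [hu]
      simp

/-- A network that is constant near `-∞` has total slope zero there. -/
theorem slope_atBot {H : ℕ} {θ : ReLUNet H} {l : ℝ}
    (h : ∀ z, z ≤ l → θ.eval z = θ.eval l) :
    ∑ n, (if θ.u n < 0 then θ.v n * θ.u n else 0) = 0 := by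
  -- The reflection `z ↦ -z` reduces this to the behavior at `+∞`.
  let θ' : ReLUNet H := ⟨θ.v, fun n => -θ.u n, θ.b, θ.c⟩
  have he : ∀ z, θ'.eval z = θ.eval (-z) := by
    intro z
    simp only [ReLUNet.eval, θ']
    simp
  have := slope_atTop (θ := θ') (r := -l) fun z hz => by
    rw [he, he, h _ (by linarith), neg_neg]
  simp only [θ', Left.neg_pos_iff, mul_neg] at this
  refine neg_eq_zero.1 (Eq.trans ?_ this)
  rw [← Finset.sum_neg_distrib]
  refine Finset.sum_congr rfl fun n _ => ?_
  split_ifs <;> simp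

theorem sum_coeff_mul_max_left {X : Finset ℝ} {d : ℝ → ℝ} (c t : ℝ) :
    ∑ p ∈ X, d p * max 0 (t - p) = spl X d c t - c := by
  unfold spl
  ring

theorem sum_coeff_mul_max_right {X : Finset ℝ} {d : ℝ → ℝ} (hd : ∑ p ∈ X, d p = 0) (c t : ℝ) :
    ∑ p ∈ X, d p * max 0 (p - t) = ∑ p ∈ X, d p * p + (spl X d c t - c) := by
  have h : ∀ p, d p * max 0 (p - t) = d p * p + d p * max 0 (t - p) - d p * t := by
    intro p
    rcases le_total p t with h | h
    · rw [max_eq_left (by linarith), max_eq_right (by linarith)]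
      ring
    · rw [max_eq_right (by linarith), max_eq_left (by linarith)]
      ring
  simp_rw [h, Finset.sum_sub_distrib, Finset.sum_add_distrib, ← Finset.sum_mul, hd,
    sum_coeff_mul_max_left c t]
  ring

/-- Testing one neuron against the slope changes of a spline. -/
theorem sum_coeff_mul_neuron {X : Finset ℝ} {d : ℝ → ℝ} (hd : ∑ p ∈ X, d p = 0) (c u b : ℝ) :
    ∑ p ∈ X, d p * max 0 (u * p + b) = |u| * spl X d c (-b / u)
      + (if 0 < u then u else 0) * (∑ p ∈ X, d p * p - c)
      + (if u < 0 then u else 0) * c := by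
  rcases lt_trichotomy u 0 with hu | hu | hu
  · have h : ∀ p, d p * max 0 (u * p + b) = (-u) * (d p * max 0 (-b / u - p)) := by
      intro p
      have : u * p + b = (-u) * (-b / u - p) := by
        have := hu.ne
        field_simp
        ring
      rw [this, ← mul_zero (-u), ← mul_max_of_nonneg _ _ (by linarith), mul_zero]
      ring
    simp_rw [h, ← Finset.mul_sum, sum_coeff_mul_max_left c, if_neg hu.not_gt, if_pos hu,
      abs_of_neg hu]
    ring
  -- A neuron with `u = 0` is constant and is annihilated by `∑ d = 0`; the factor `|u|` cancels the
  -- meaningless `-b / u`.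
  · subst hu
    simp [← Finset.sum_mul, hd]
  · have h : ∀ p, d p * max 0 (u * p + b) = u * (d p * max 0 (p - -b / u)) := by
      intro p
      have : u * p + b = u * (p - -b / u) := by
        have := hu.ne'
        field_simp
        ring
      rw [this, ← mul_zero u, ← mul_max_of_nonneg _ _ (by linarith), mul_zero]
      ring
    simp_rw [h, ← Finset.mul_sum, sum_coeff_mul_max_right hd c, if_neg hu.not_gt, if_pos hu,
      abs_of_pos hu]
    ring

/-- The slope changes `d` serve as a dual certificate. Paired with `d`, a neuron gives `|u|` times
the spline at its breakpoint, up to terms that cancel in the sum because the network has slope zero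
at both ends. Since the spline is bounded by `1`, each neuron contributes at most `|v| * |u|`, and
`2 * |v| * |u| ≤ v ^ 2 + u ^ 2`. -/
theorem energy_le {H : ℕ} {θ : ReLUNet H} {X : Finset ℝ} {y d : ℝ → ℝ} {c : ℝ}
    (hX : X.Nonempty) (hs : IsSpline X y d c) (hy : ∀ p ∈ X, |y p| ≤ 1)
    (hθ : θ.Fits (graph X y)) :
    2 * (-∑ p ∈ X, d p * y p) ≤ (∑ n, θ.v n ^ 2) + ∑ n, θ.u n ^ 2 := by
  have hr : ∑ n, (if 0 < θ.u n then θ.v n * θ.u n else 0) = 0 :=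
    have hm := X.max'_mem hX
    slope_atTop fun z hz => hθ.2.2 _ (mk_mem_graph hm)
      (fun q hq => X.le_max' _ (mem_graph.1 hq).1) z hz
  have hl : ∑ n, (if θ.u n < 0 then θ.v n * θ.u n else 0) = 0 :=
    have hm := X.min'_mem hX
    slope_atBot fun z hz => hθ.2.1 _ (mk_mem_graph hm)
      (fun q hq => X.min'_le _ (mem_graph.1 hq).1) z hz
  have key : ∑ p ∈ X, d p * y p
      = ∑ n, θ.v n * (|θ.u n| * spl X d c (-θ.b n / θ.u n)) := by
    calc ∑ p ∈ X, d p * y p = ∑ p ∈ X, d p * θ.eval p :=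
          Finset.sum_congr rfl fun p hp => by rw [hθ.1 _ (mk_mem_graph hp)]
      _ = ∑ n, θ.v n * ∑ p ∈ X, d p * max 0 (θ.u n * p + θ.b n) := by
          simp_rw [ReLUNet.eval, mul_add, Finset.sum_add_distrib, ← Finset.sum_mul,
            hs.sum_zero, zero_mul, add_zero, Finset.mul_sum]
          rw [Finset.sum_comm]
          exact Finset.sum_congr rfl fun n _ => Finset.sum_congr rfl fun p _ => by ring
      _ = ∑ n, (θ.v n * (|θ.u n| * spl X d c (-θ.b n / θ.u n))
            + (if 0 < θ.u n then θ.v n * θ.u n else 0) * (∑ p ∈ X, d p * p - c)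
            + (if θ.u n < 0 then θ.v n * θ.u n else 0) * c) := by
          refine Finset.sum_congr rfl fun n _ => ?_
          rw [sum_coeff_mul_neuron hs.sum_zero c]
          split_ifs <;> ring
      _ = _ := by
          rw [Finset.sum_add_distrib, Finset.sum_add_distrib, ← Finset.sum_mul,
            ← Finset.sum_mul, hr, hl]
          ring
  rw [key, ← Finset.sum_neg_distrib, Finset.mul_sum, ← Finset.sum_add_distrib]
  refine Finset.sum_le_sum fun n _ => ?_
  have h1 := hs.abs_le_one hX hy (-θ.b n / θ.u n)
  have h2 : -(θ.v n * (|θ.u n| * spl X d c (-θ.b n / θ.u n))) ≤ |θ.v n| * |θ.u n| := by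
    refine (neg_le_abs _).trans ?_
    rw [abs_mul, abs_mul, abs_abs]
    exact mul_le_mul_of_nonneg_left (mul_le_of_le_one_right (abs_nonneg _) h1) (abs_nonneg _)
  nlinarith [sq_nonneg (|θ.v n| - |θ.u n|), sq_abs (θ.v n), sq_abs (θ.u n)]

/-- One neuron per knot, with both weights of modulus `√|d p|`, gives equality in the
arithmetic-geometric mean inequality of `energy_le`. The remaining neurons are zero. -/
theorem exists_net_of_isSpline {H : ℕ} {X : Finset ℝ} {y d : ℝ → ℝ} {c : ℝ}
    (hs : IsSpline X y d c) (hy : ∀ p ∈ X, y p = 1 ∨ y p = -1) (hH : X.card ≤ H) :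
    ∃ θ : ReLUNet H, (∀ z, θ.eval z = spl X d c z) ∧
      (∑ n, θ.v n ^ 2) + ∑ n, θ.u n ^ 2 = 2 * (-∑ p ∈ X, d p * y p) := by
  obtain ⟨e⟩ : Nonempty (X ↪ Fin H) := Function.Embedding.nonempty_of_card_le (by simpa using hH)
  have hext : ∀ φ : X → ℝ, ∑ n, Function.extend e φ 0 n = ∑ p : X, φ p := by
    intro φ
    rw [← Finset.sum_subset (Finset.subset_univ (Finset.univ.map e)), Finset.sum_map]
    · exact Finset.sum_congr rfl fun p _ => e.injective.extend_apply _ _ _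
    · intro n _ hn
      rw [Function.extend_apply' _ _ _ (by simpa using hn)]
      rfl
  have hcomp : ∀ (φ ψ χ : X → ℝ) (F : ℝ → ℝ → ℝ → ℝ), F 0 0 0 = 0 →
      ∑ n, F (Function.extend e φ 0 n) (Function.extend e ψ 0 n) (Function.extend e χ 0 n)
        = ∑ p : X, F (φ p) (ψ p) (χ p) := by
    intro φ ψ χ F hF
    rw [← hext]
    refine Finset.sum_congr rfl fun n _ => ?_
    by_cases hn : ∃ p, e p = n
    · obtain ⟨p, rfl⟩ := hn
      simp only [e.injective.extend_apply]
    · simp only [Function.extend_apply' _ _ _ hn, Pi.zero_apply, hF]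
  let v : X → ℝ := fun p => SignType.sign (d p) * Real.sqrt |d p|
  let u : X → ℝ := fun p => Real.sqrt |d p|
  have huu : ∀ p : X, u p ^ 2 = |d p| := fun p => Real.sq_sqrt (abs_nonneg _)
  have hvv : ∀ p : X, v p ^ 2 = |d p| := by
    intro p
    simp only [v, mul_pow]
    rw [Real.sq_sqrt (abs_nonneg _)]
    rcases lt_trichotomy (d p) 0 with h | h | h <;> simp [h]
  have hvu : ∀ p : X, v p * u p = d p := by
    intro p
    simp only [v, u, mul_assoc]
    rw [Real.mul_self_sqrt (abs_nonneg _)]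
    exact sign_mul_abs _
  refine ⟨⟨Function.extend e v 0, Function.extend e u 0,
    Function.extend e (fun p => -(u p * p)) 0, c⟩, fun z => ?_, ?_⟩
  · simp only [ReLUNet.eval]
    rw [hcomp v u _ (fun v u b => v * max 0 (u * z + b)) (by simp)]
    unfold spl
    rw [add_comm, ← Finset.sum_coe_sort X]
    congr 1
    refine Finset.sum_congr rfl fun p _ => ?_
    have hu0 : 0 ≤ u p := Real.sqrt_nonneg _
    have : u p * z + -(u p * p) = u p * (z - p) := by ring
    rw [this, ← mul_zero (u p), ← mul_max_of_nonneg _ _ hu0, ← mul_assoc, hvu, mul_zero]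
  · simp only
    rw [hcomp v v v (fun v _ _ => v ^ 2) (by simp), hcomp u u u (fun v _ _ => v ^ 2) (by simp)]
    simp_rw [huu, hvv]
    rw [Finset.sum_coe_sort X (fun p => |d p|), ← two_mul, ← Finset.sum_neg_distrib]
    congr 1
    exact Finset.sum_congr rfl fun p hp => hs.abs_coeff hy hp

section

variable {H : ℕ} {X : Finset ℝ} {y d : ℝ → ℝ} {c : ℝ}

theorem minNorm_graph (hX : X.Nonempty) (hs : IsSpline X y d c)
    (hy : ∀ p ∈ X, y p = 1 ∨ y p = -1) (hH : X.card ≤ H) :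
    minNorm H (graph X y) = ENNReal.ofReal (Real.sqrt (2 * (-∑ p ∈ X, d p * y p))) := by
  obtain ⟨θ, hθ, hn⟩ := exists_net_of_isSpline hs hy hH
  refine le_antisymm ?_ ?_
  · refine (iInf₂_le θ (fits_of_isSpline hs hθ)).trans ?_
    rw [ReLUNet.weightNorm, hn]
  · refine le_iInf₂ fun θ' hθ' => ENNReal.ofReal_le_ofReal (Real.sqrt_le_sqrt ?_)
    exact energy_le hX hs (fun p hp => by rcases hy p hp with h | h <;> simp [h]) hθ'

theorem minNormFun_graph (hX : X.Nonempty) (hs : IsSpline X y d c)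
    (hy : ∀ p ∈ X, y p = 1 ∨ y p = -1) (hH : X.card ≤ H) :
    minNormFun H (graph X y) = spl X d c := by
  obtain ⟨θ, hθ, hn⟩ := exists_net_of_isSpline hs hy hH
  have hex : ∃ θ : ReLUNet H, θ.IsMinNorm (graph X y) ∧
      LinearBetweenNeighbors θ.eval (graph X y) := by
    refine ⟨θ, ⟨fits_of_isSpline hs hθ, fun θ' hθ' => ?_⟩, ?_⟩
    · unfold ReLUNet.weightNorm
      rw [hn]
      refine Real.sqrt_le_sqrt ?_
      exact energy_le hX hs (fun p hp => by rcases hy p hp with h | h <;> simp [h]) hθ'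
    · rw [funext hθ]
      exact linearBetween_of_isSpline
  unfold minNormFun
  rw [dif_pos hex]
  have := Classical.choose_spec hex
  exact eq_spl_of_fits hX hs this.1.1 this.2

end

/-! ### The `L²` norm of a tent function. -/

theorem continuous_tent (a w b : ℝ) : Continuous (tent a w b) := by
  unfold tent
  fun_prop

theorem integral_tent_sq {a w b : ℝ} (ha : 0 ≤ a) (haw : a < w) (hwb : w < b) (hb : b ≤ 1) :
    ∫ z in (0 : ℝ)..1, tent a w b z ^ 2 = (b - a) / 3 := by
  have hi : ∀ s t : ℝ, IntervalIntegrable (fun z => tent a w b z ^ 2) MeasureTheory.volume s t :=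
    fun s t => ((continuous_tent a w b).pow 2).intervalIntegrable s t
  rw [← intervalIntegral.integral_add_adjacent_intervals (hi 0 a) (hi a 1),
    ← intervalIntegral.integral_add_adjacent_intervals (hi a w) (hi w 1),
    ← intervalIntegral.integral_add_adjacent_intervals (hi w b) (hi b 1)]
  have h1 : ∫ z in (0 : ℝ)..a, tent a w b z ^ 2 = 0 := by
    rw [intervalIntegral.integral_congr (g := fun _ => 0)]
    · simp
    · intro z hz
      rw [Set.uIcc_of_le ha] at hz
      simp [tent_left haw hwb hz.2]
  have h4 : ∫ z in b..1, tent a w b z ^ 2 = 0 := by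
    rw [intervalIntegral.integral_congr (g := fun _ => 0)]
    · simp
    · intro z hz
      rw [Set.uIcc_of_le hb] at hz
      simp [tent_right haw hwb hz.1]
  have h2 : ∫ z in a..w, tent a w b z ^ 2 = (w - a) / 3 := by
    rw [intervalIntegral.integral_congr (g := fun z => (w - a)⁻¹ ^ 2 * (z - a) ^ 2)]
    · rw [intervalIntegral.integral_const_mul,
        intervalIntegral.integral_comp_sub_right (fun z => z ^ 2), integral_pow]
      have : w - a ≠ 0 := by linarith
      push_cast
      field_simp
      ring
    · intro z hz
      rw [Set.uIcc_of_le haw.le] at hz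
      simp only
      rw [tent_mid_left hwb hz.1 hz.2]
      ring
  have h3 : ∫ z in w..b, tent a w b z ^ 2 = (b - w) / 3 := by
    rw [intervalIntegral.integral_congr (g := fun z => (b - w)⁻¹ ^ 2 * (b - z) ^ 2)]
    · rw [intervalIntegral.integral_const_mul,
        intervalIntegral.integral_comp_sub_left (fun z => z ^ 2), integral_pow]
      have : b - w ≠ 0 := by linarith
      push_cast
      field_simp
      ring
    · intro z hz
      rw [Set.uIcc_of_le hwb.le] at hz
      simp only
      rw [tent_mid_right haw hwb hz.1 hz.2]
      ring
  rw [h1, h2, h3, h4]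
  ring

theorem lintegral_mul_tent_sq {a w b : ℝ} (ha : 0 ≤ a) (haw : a < w) (hwb : w < b) (hb : b ≤ 1)
    (κ : ℝ) : ∫⁻ z in Set.Icc (0 : ℝ) 1, ENNReal.ofReal (|κ * tent a w b z| ^ 2)
      = ENNReal.ofReal (κ ^ 2 * ((b - a) / 3)) := by
  have hc : Continuous fun z => |κ * tent a w b z| ^ 2 :=
    ((continuous_const.mul (continuous_tent a w b)).abs).pow 2
  rw [← MeasureTheory.ofReal_integral_eq_lintegral_ofReal
    (hc.integrableOn_Icc) (Filter.Eventually.of_forall fun z => by positivity),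
    MeasureTheory.integral_Icc_eq_integral_Ioc, ← intervalIntegral.integral_of_le zero_le_one,
    ← integral_tent_sq ha haw hwb hb, ← intervalIntegral.integral_const_mul]
  simp_rw [sq_abs, mul_pow]

/-! ### The two scores inside a gap. -/

theorem insert_graph {X : Finset ℝ} {y : ℝ → ℝ} {w : ℝ} (hw : w ∉ X) (t : ℝ)
    [DecidableEq (ℝ × ℝ)] :
    insert (w, t) (graph X y) = graph (insert w X) (Function.update y w t) := by
  ext p
  rw [Finset.mem_insert, mem_graph, mem_graph, Finset.mem_insert]
  by_cases h : p.1 = w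
  · rw [h, Function.update_self, Prod.ext_iff]
    simp [hw, h]
  · rw [Function.update_of_ne h, Prod.ext_iff]
    simp [h]

theorem estLabel_eq (H : ℕ) (L : Finset (ℝ × ℝ)) (w : ℝ) [DecidableEq (ℝ × ℝ)] :
    (estLabel H L w = 1 ∨ estLabel H L w = -1) ∧
      minNorm H (insert (w, estLabel H L w) L) ≤ minNorm H (insert (w, -estLabel H L w) L) := by
  unfold estLabel
  split_ifs with h
  · refine ⟨Or.inl rfl, ?_⟩
    convert h
  · refine ⟨Or.inr rfl, ?_⟩
    rw [neg_neg]
    refine le_trans (le_of_eq ?_) ((not_le.1 h).le.trans (le_of_eq ?_)) <;> congr <;>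
      exact Subsingleton.elim _ _

section

variable {H : ℕ} {X : Finset ℝ} {y d : ℝ → ℝ} {c a b w : ℝ}

theorem IsSpline.energy_nonneg (hs : IsSpline X y d c) (hy : ∀ p ∈ X, y p = 1 ∨ y p = -1) :
    0 ≤ -∑ p ∈ X, d p * y p := by
  rw [← Finset.sum_neg_distrib]
  exact Finset.sum_nonneg fun p hp => by rw [← hs.abs_coeff hy hp]; exact abs_nonneg _

/-- The increase of the energy caused by giving `w` between the neighbors `a, b` the label `t`. -/
def energyIncr (y : ℝ → ℝ) (a b w t : ℝ) : ℝ :=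
  (t - (y a + (y b - y a) * ((w - a) / (b - a)))) *
    ((w - a)⁻¹ * (t - y a) + (b - w)⁻¹ * (t - y b))

/-- Energy, minimum norm and interpolator after labeling a point `w` inside a gap `(a, b)` by `t`. -/
theorem minNorm_insert (hs : IsSpline X y d c) (hy : ∀ p ∈ X, y p = 1 ∨ y p = -1)
    (hH : X.card + 1 ≤ H) (hg : IsGap X a b) (haw : a < w) (hwb : w < b) {t : ℝ}
    (ht : t = 1 ∨ t = -1) [DecidableEq (ℝ × ℝ)] :
    0 ≤ -∑ p ∈ X, d p * y p + energyIncr y a b w t ∧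
    minNorm H (insert (w, t) (graph X y)) = ENNReal.ofReal
      (Real.sqrt (2 * (-∑ p ∈ X, d p * y p + energyIncr y a b w t))) ∧
    minNormFun H (insert (w, t) (graph X y)) = fun z => spl X d c z
      + (t - (y a + (y b - y a) * ((w - a) / (b - a)))) * tent a w b z := by
  have hw : w ∉ X := fun h => by rcases hg.2.2.2 w h with h | h <;> linarith
  have hup : ∀ p ∈ X, Function.update y w t p = y p := fun p hp =>
    Function.update_of_ne (fun h : p = w => hw (h ▸ hp)) _ _
  have hy' : ∀ p ∈ insert w X, Function.update y w t p = 1 ∨ Function.update y w t p = -1 := by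
    intro p hp
    rcases Finset.mem_insert.1 hp with rfl | hp
    · rwa [Function.update_self]
    · rw [hup p hp]
      exact hy p hp
  have hc : (insert w X).card ≤ H := (Finset.card_insert_le _ _).trans hH
  obtain ⟨d', hs', hf, he⟩ := hs.insert_knot hg haw hwb (Function.update y w t) hup
  rw [Function.update_self, hs.eq_on_gap hg ⟨haw.le, hwb.le⟩] at hf he
  have hnn := hs'.energy_nonneg hy'
  rw [he] at hnn
  rw [insert_graph hw, minNorm_graph (Finset.insert_nonempty _ _) hs' hy' hc, he,
    minNormFun_graph (Finset.insert_nonempty _ _) hs' hy' hc]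
  exact ⟨hnn, rfl, funext hf⟩

/-- The base value of each score, attained at points that do not change the interpolator. -/
def baseScore (cr : Criterion) (H : ℕ) (L : Finset (ℝ × ℝ)) : ℝ≥0∞ :=
  match cr with
  | .functionNorm => minNorm H L
  | .dataNorm => 0

theorem le_of_ofReal_sqrt_le {s t : ℝ} (ht : 0 ≤ t)
    (h : ENNReal.ofReal (Real.sqrt (2 * s)) ≤ ENNReal.ofReal (Real.sqrt (2 * t))) : s ≤ t := by
  rw [ENNReal.ofReal_le_ofReal_iff (Real.sqrt_nonneg _),
    Real.sqrt_le_sqrt_iff (by linarith)] at h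
  linarith

theorem energyIncr_estLabel_le (hs : IsSpline X y d c) (hy : ∀ p ∈ X, y p = 1 ∨ y p = -1)
    (hH : X.card + 1 ≤ H) (hg : IsGap X a b) (haw : a < w) (hwb : w < b) :
    energyIncr y a b w (estLabel H (graph X y) w)
      ≤ energyIncr y a b w (-estLabel H (graph X y) w) := by
  classical
  obtain ⟨ht, hle⟩ := estLabel_eq H (graph X y) w
  obtain ⟨-, h₁, -⟩ := minNorm_insert hs hy hH hg haw hwb ht
  obtain ⟨h0, h₂, -⟩ := minNorm_insert (t := -estLabel H (graph X y) w) hs hy hH hg haw hwb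
    (by rcases ht with h | h <;> simp [h])
  rw [h₁, h₂] at hle
  have := le_of_ofReal_sqrt_le h0 hle
  linarith

/-- The common label costs no energy and the other one does, so the estimated label is the common
one and the interpolator stays the same. -/
theorem score_of_same (cr : Criterion) (hs : IsSpline X y d c)
    (hy : ∀ p ∈ X, y p = 1 ∨ y p = -1) (hH : X.card + 1 ≤ H) (hg : IsGap X a b) (haw : a < w)
    (hwb : w < b) (hab : y a = y b) :
    score cr H (graph X y) w = baseScore cr H (graph X y) := by
  classical
  obtain ⟨ht, -⟩ := estLabel_eq H (graph X y) w
  have hle := energyIncr_estLabel_le hs hy hH hg haw hwb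
  have hX : X.Nonempty := ⟨a, hg.1⟩
  have hta : estLabel H (graph X y) w = y a := by
    by_contra hne
    have hneg : -estLabel H (graph X y) w = y a := by
      rcases ht with h | h <;> rcases hy a hg.1 with h' | h' <;> rw [h, h'] at hne ⊢ <;>
        first | exact absurd rfl hne | norm_num
    have hneg' : estLabel H (graph X y) w = -y a := by linarith
    rw [hneg, hneg'] at hle
    simp only [energyIncr, ← hab, sub_self, zero_mul, add_zero] at hle
    have h1 : 0 < (w - a)⁻¹ := inv_pos.2 (by linarith)
    have h2 : 0 < (b - w)⁻¹ := inv_pos.2 (by linarith)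
    have h3 : y a * y a = 1 := by rcases hy a hg.1 with h' | h' <;> rw [h'] <;> norm_num
    nlinarith
  obtain ⟨-, h₁, h₂⟩ := minNorm_insert hs hy hH hg haw hwb ht
  rw [hta] at h₁ h₂
  simp only [energyIncr, ← hab, sub_self, zero_mul, add_zero] at h₁ h₂
  have haug : augment H (graph X y) w = insert (w, y a) (graph X y) := by
    rw [augment, hta]
  cases cr with
  | functionNorm =>
    simp only [score, baseScore]
    rw [haug, h₁, minNorm_graph hX hs hy (by omega)]
  | dataNorm =>
    simp only [score, baseScore]
    rw [haug, h₂, minNormFun_graph hX hs hy (by omega)]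
    simp

/-- The score of a point at distance `δ` from the nearest end of a gap of length `ℓ` whose ends
have opposite labels; `e` is the current energy. -/
def oppScore (cr : Criterion) (e ℓ δ : ℝ) : ℝ≥0∞ :=
  match cr with
  | .functionNorm => ENNReal.ofReal (Real.sqrt (2 * (e + 4 * ((ℓ - δ)⁻¹ - ℓ⁻¹))))
  | .dataNorm => ENNReal.ofReal (4 * δ ^ 2 / (3 * ℓ))

/-- The cheaper label is that of the nearer end, at distance `δ`, and in a tie both labels give the
same formulas. The interpolator moves by `2 * δ / ℓ` in absolute value at `w`, which scales a tent
of squared norm `ℓ / 3`. -/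
theorem score_of_opp (cr : Criterion) (hs : IsSpline X y d c)
    (hy : ∀ p ∈ X, y p = 1 ∨ y p = -1) (hH : X.card + 1 ≤ H) (hg : IsGap X a b) (haw : a < w)
    (hwb : w < b) (ha : 0 ≤ a) (hb : b ≤ 1) (hab : y a ≠ y b) :
    score cr H (graph X y) w
      = oppScore cr (-∑ p ∈ X, d p * y p) (b - a) (min (w - a) (b - w)) := by
  classical
  obtain ⟨ht, -⟩ := estLabel_eq H (graph X y) w
  have hle := energyIncr_estLabel_le hs hy hH hg haw hwb
  have hX : X.Nonempty := ⟨a, hg.1⟩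
  have hyb : y b = -y a := by
    rcases hy a hg.1 with h | h <;> rcases hy b hg.2.1 with h' | h' <;> rw [h, h'] at hab ⊢ <;>
      first | exact absurd rfl hab | norm_num
  have h3 : y a * y a = 1 := by rcases hy a hg.1 with h' | h' <;> rw [h'] <;> norm_num
  have hwa0 : 0 < w - a := by linarith
  have hbw0 : 0 < b - w := by linarith
  have hba0 : 0 < b - a := by linarith
  have ia : energyIncr y a b w (y a) = 4 * ((b - w)⁻¹ - (b - a)⁻¹) := by
    calc energyIncr y a b w (y a) = (y a * y a) * (4 * ((w - a) / (b - a)) * (b - w)⁻¹) := by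
          rw [energyIncr, hyb]
          ring
      _ = _ := by
          rw [h3]
          field_simp
          ring
  have ib : energyIncr y a b w (-y a) = 4 * ((w - a)⁻¹ - (b - a)⁻¹) := by
    calc energyIncr y a b w (-y a)
        = (y a * y a) * (4 * (1 - (w - a) / (b - a)) * (w - a)⁻¹) := by
          rw [energyIncr, hyb]
          ring
      _ = _ := by
          rw [h3]
          field_simp
  obtain ⟨-, h₁, h₂⟩ := minNorm_insert hs hy hH hg haw hwb ht
  set κ := estLabel H (graph X y) w - (y a + (y b - y a) * ((w - a) / (b - a))) with hκ
  have key : energyIncr y a b w (estLabel H (graph X y) w)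
        = 4 * ((b - a - min (w - a) (b - w))⁻¹ - (b - a)⁻¹) ∧
      κ ^ 2 = 4 * (min (w - a) (b - w)) ^ 2 / (b - a) ^ 2 := by
    have hcases : estLabel H (graph X y) w = y a ∨ estLabel H (graph X y) w = -y a := by
      rcases ht with h | h <;> rcases hy a hg.1 with h' | h' <;> rw [h, h'] <;> norm_num
    rcases hcases with h | h
    · rw [h, ia, ib] at hle
      have : w - a ≤ b - w := (inv_le_inv₀ hbw0 hwa0).1 (by linarith)
      rw [h, ia, min_eq_left this]
      refine ⟨by congr 3; ring, ?_⟩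
      calc κ ^ 2 = (y a * y a) * (4 * (w - a) ^ 2 / (b - a) ^ 2) := by
            rw [hκ, h, hyb]
            field_simp
            ring
        _ = _ := by rw [h3, one_mul]
    · rw [h, neg_neg, ia, ib] at hle
      have : b - w ≤ w - a := (inv_le_inv₀ hwa0 hbw0).1 (by linarith)
      rw [h, ib, min_eq_right this]
      refine ⟨by congr 3; ring, ?_⟩
      calc κ ^ 2 = (y a * y a) * (4 * (b - w) ^ 2 / (b - a) ^ 2) := by
            rw [hκ, h, hyb]
            field_simp
            ring
        _ = _ := by rw [h3, one_mul]
  have haug : augment H (graph X y) w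
      = insert (w, estLabel H (graph X y) w) (graph X y) := by
    rw [augment]
  cases cr with
  | functionNorm =>
    simp only [score, oppScore]
    rw [haug, h₁, key.1]
  | dataNorm =>
    simp only [score, oppScore]
    rw [haug, h₂, minNormFun_graph hX hs hy (by omega)]
    simp only [add_sub_cancel_left]
    rw [lintegral_mul_tent_sq ha haw hwb hb, key.2]
    congr 1
    field_simp

/-- For fixed `e` and `ℓ` both scores are strictly increasing in `δ`. Only points of the same gap
are ever compared in this way; which gap wins does not matter. -/
theorem oppScore_le_imp {cr : Criterion} {e ℓ δ δ' : ℝ} (he : 0 ≤ e) (hδ : 0 < δ) (hδ' : 0 ≤ δ')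
    (hδℓ : δ < ℓ) (hδ'ℓ : δ' < ℓ) (h : oppScore cr e ℓ δ ≤ oppScore cr e ℓ δ') : δ ≤ δ' := by
  have hℓ : 0 < ℓ := by linarith
  cases cr with
  | functionNorm =>
    have h0 : ℓ⁻¹ ≤ (ℓ - δ')⁻¹ := (inv_le_inv₀ hℓ (by linarith)).2 (by linarith)
    have := le_of_ofReal_sqrt_le (by linarith) h
    have := (inv_le_inv₀ (a := ℓ - δ) (b := ℓ - δ') (by linarith) (by linarith)).1 (by linarith)
    linarith
  | dataNorm =>
    simp only [oppScore] at h
    rw [ENNReal.ofReal_le_ofReal_iff (by positivity), div_le_div_iff_of_pos_right (by linarith)]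
      at h
    exact (pow_le_pow_iff_left₀ hδ.le hδ' two_ne_zero).1 (by linarith)

/-- This gives points between opposite labels priority over points between equal labels. -/
theorem baseScore_lt_oppScore {cr : Criterion} {ℓ δ : ℝ} (hs : IsSpline X y d c)
    (hX : X.Nonempty) (hy : ∀ p ∈ X, y p = 1 ∨ y p = -1) (hH : X.card + 1 ≤ H) (hδ : 0 < δ)
    (hδℓ : δ < ℓ) : baseScore cr H (graph X y) < oppScore cr (-∑ p ∈ X, d p * y p) ℓ δ := by
  have hℓ : 0 < ℓ := by linarith
  cases cr with
  | functionNorm =>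
    simp only [baseScore, oppScore]
    rw [minNorm_graph hX hs hy (by omega)]
    by_contra hc
    have := le_of_ofReal_sqrt_le (hs.energy_nonneg hy) (not_lt.1 hc)
    have h1 : ℓ⁻¹ < (ℓ - δ)⁻¹ := (inv_lt_inv₀ hℓ (by linarith)).2 (by linarith)
    linarith
  | dataNorm =>
    simp only [baseScore, oppScore]
    rw [ENNReal.ofReal_pos]
    positivity

end

/-! ### The cost of a gap and its decrease under bisection. -/

/-- The points of the pool `Q` strictly between `a` and `b`. -/
def between (Q : Finset ℝ) (a b : ℝ) : Set ℝ := {z | z ∈ Q ∧ a < z ∧ z < b}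

theorem between_subset {Q : Finset ℝ} {a b a' b' : ℝ} (ha : a ≤ a') (hb : b' ≤ b) :
    between Q a' b' ⊆ between Q a b :=
  fun _ hz => ⟨hz.1, ha.trans_lt hz.2.1, hz.2.2.trans_le hb⟩

theorem isBounded_between (Q : Finset ℝ) (a b : ℝ) : Bornology.IsBounded (between Q a b) :=
  (Q.finite_toSet.subset fun _ hz => hz.1).isBounded

open Classical in
/-- An upper bound for the number of bisections that `Q` admits in the gap `(a, b)`, for
`δ`-separated pools. -/
def cost (Q : Finset ℝ) (δ a b : ℝ) : ℝ :=
  if (between Q a b).Nonempty then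
    -- A gap containing a point has length at least `2 * δ`, so the quotient is at least `1`. Adding
    -- `δ` keeps the product positive when only one point is left.
    1 + 4 * Real.log ((b - a) * (Metric.diam (between Q a b) + δ) / (2 * δ ^ 2))
  else 0

/-- A `δ`-separated pool in `[0,1]`, labeled by `g` with values `±1`, whose points are classified
into `k` consecutive pieces of constant label by `pc`. -/
structure Pool (Q : Finset ℝ) (g : ℝ → ℝ) (pc : ℝ → ℕ) (k : ℕ) (δ : ℝ) : Prop where
  pos : 0 < δ
  le_one : δ ≤ 1
  sep : ∀ z ∈ Q, ∀ w ∈ Q, z < w → δ ≤ w - z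
  mem_unit : ∀ z ∈ Q, 0 ≤ z ∧ z ≤ 1
  label : ∀ z ∈ Q, g z = 1 ∨ g z = -1
  pc_lt : ∀ z ∈ Q, pc z < k
  pc_mono : ∀ z ∈ Q, ∀ w ∈ Q, z ≤ w → pc z ≤ pc w
  pc_const : ∀ z ∈ Q, ∀ w ∈ Q, pc z = pc w → g z = g w

/-- A bound for `cost` on `[0,1]`. -/
def maxCost (δ : ℝ) : ℝ := 1 + 8 * Real.log δ⁻¹

section

variable {Q A : Finset ℝ} {g : ℝ → ℝ} {pc : ℝ → ℕ} {k : ℕ} {δ a b w : ℝ}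

theorem Pool.maxCost_nonneg (hQ : Pool Q g pc k δ) : 0 ≤ maxCost δ := by
  have := Real.log_nonneg ((one_le_inv₀ hQ.pos).2 hQ.le_one)
  unfold maxCost
  linarith

theorem Pool.two_mul_le (hQ : Pool Q g pc k δ) (ha : a ∈ Q) (hb : b ∈ Q)
    (h : (between Q a b).Nonempty) : 2 * δ ≤ b - a := by
  obtain ⟨z, hz, haz, hzb⟩ := h
  have := hQ.sep a ha z hz haz
  have := hQ.sep z hz b hb hzb
  linarith

theorem Pool.one_le_cost (hQ : Pool Q g pc k δ) (ha : a ∈ Q) (hb : b ∈ Q)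
    (h : (between Q a b).Nonempty) : 1 ≤ cost Q δ a b := by
  have hδ := hQ.pos
  rw [cost, if_pos h]
  have := hQ.two_mul_le ha hb h
  have hd : 0 ≤ Metric.diam (between Q a b) := Metric.diam_nonneg
  have : 0 ≤ Real.log ((b - a) * (Metric.diam (between Q a b) + δ) / (2 * δ ^ 2)) := by
    apply Real.log_nonneg
    rw [le_div_iff₀ (by positivity)]
    nlinarith
  linarith

theorem Pool.cost_nonneg (hQ : Pool Q g pc k δ) (ha : a ∈ Q) (hb : b ∈ Q) :
    0 ≤ cost Q δ a b := by
  by_cases h : (between Q a b).Nonempty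
  · linarith [hQ.one_le_cost ha hb h]
  · rw [cost, if_neg h]

theorem Pool.cost_le (hQ : Pool Q g pc k δ) (ha : a ∈ Q) (hb : b ∈ Q) :
    cost Q δ a b ≤ maxCost δ := by
  by_cases h : (between Q a b).Nonempty
  · have hδ := hQ.pos
    have hδ1 := hQ.le_one
    have h2 := hQ.two_mul_le ha hb h
    have hd : 0 ≤ Metric.diam (between Q a b) := Metric.diam_nonneg
    have hd1 : Metric.diam (between Q a b) ≤ 1 := by
      refine Metric.diam_le_of_forall_dist_le zero_le_one fun s hs t ht => ?_
      have h3 := hQ.mem_unit s hs.1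
      have h4 := hQ.mem_unit t ht.1
      rw [Real.dist_eq, abs_le]
      constructor <;> linarith
    have h3 := hQ.mem_unit a ha
    have h4 := hQ.mem_unit b hb
    rw [cost, if_pos h, maxCost]
    have h5 : Real.log ((b - a) * (Metric.diam (between Q a b) + δ) / (2 * δ ^ 2))
        ≤ Real.log (δ⁻¹ ^ 2) := by
      refine Real.log_le_log (by apply div_pos <;> nlinarith [sq_pos_of_pos hδ]) ?_
      rw [div_le_iff₀ (by positivity)]
      have : δ⁻¹ ^ 2 * (2 * δ ^ 2) = 2 := by field_simp
      rw [this]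
      nlinarith
    rw [Real.log_pow] at h5
    push_cast at h5
    linarith
  · rw [cost, if_neg h]
    exact hQ.maxCost_nonneg

/-- Since `log (3 / 4) ≤ -1 / 4`, the factor `4` in `cost` turns one contraction by `3 / 4` into a
decrease by at least `1`. If the new gap is empty, the cost falls from at least `1` to `0`. -/
theorem Pool.cost_le_sub_one (hQ : Pool Q g pc k δ) {a' b' : ℝ} (ha : a ∈ Q) (hb : b ∈ Q)
    (ha' : a' ∈ Q) (hb' : b' ∈ Q) (hne : (between Q a b).Nonempty)
    (h : (between Q a' b').Nonempty → (b' - a') * (Metric.diam (between Q a' b') + δ)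
      ≤ 3 / 4 * ((b - a) * (Metric.diam (between Q a b) + δ))) :
    cost Q δ a' b' ≤ cost Q δ a b - 1 := by
  by_cases hne' : (between Q a' b').Nonempty
  · have hδ := hQ.pos
    have h2 := hQ.two_mul_le ha hb hne
    have h2' := hQ.two_mul_le ha' hb' hne'
    have hd : 0 ≤ Metric.diam (between Q a b) := Metric.diam_nonneg
    have hd' : 0 ≤ Metric.diam (between Q a' b') := Metric.diam_nonneg
    rw [cost, cost, if_pos hne, if_pos hne']
    set s := (b - a) * (Metric.diam (between Q a b) + δ)
    set s' := (b' - a') * (Metric.diam (between Q a' b') + δ)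
    have hs : 0 < s := mul_pos (by linarith) (by linarith)
    have hs' : 0 < s' := mul_pos (by linarith) (by linarith)
    have h3 : Real.log (s' / (2 * δ ^ 2)) ≤ Real.log (3 / 4) + Real.log (s / (2 * δ ^ 2)) := by
      rw [← Real.log_mul (by norm_num) (by positivity)]
      refine Real.log_le_log (by positivity) ?_
      rw [← mul_div_assoc]
      exact div_le_div_of_nonneg_right (h hne') (by positivity)
    have h4 : Real.log (3 / 4 : ℝ) ≤ 3 / 4 - 1 := Real.log_le_sub_one_of_pos (by norm_num)
    linarith
  · rw [cost, if_neg hne']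
    linarith [hQ.one_le_cost ha hb hne]

/-- `w` is a point of the pool inside `(a, b)` as far from the ends as possible. -/
def IsCentral (Q : Finset ℝ) (a b w : ℝ) : Prop :=
  w ∈ between Q a b ∧ ∀ z ∈ between Q a b, min (z - a) (b - z) ≤ min (w - a) (b - w)

/-- If `w` is at least a quarter of the length away from `a`, the length contracts and the diameter
does not grow. Otherwise centrality forces every point right of `w` to within `w - a` of `b`. Those
points have diameter at most a quarter of the length, whereas together with `w` they spanned at
least half of it, so the diameter term contracts. -/
theorem Pool.cost_right (hQ : Pool Q g pc k δ) (ha : a ∈ Q) (hb : b ∈ Q)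
    (hw : IsCentral Q a b w) : cost Q δ w b ≤ cost Q δ a b - 1 := by
  obtain ⟨hwI, hmax⟩ := hw
  have hδ := hQ.pos
  obtain ⟨hwQ, haw, hwb⟩ := id hwI
  refine hQ.cost_le_sub_one ha hb hwQ hb ⟨w, hwI⟩ fun hne => ?_
  have hbd := isBounded_between Q a b
  have hmono : Metric.diam (between Q w b) ≤ Metric.diam (between Q a b) :=
    Metric.diam_mono (between_subset haw.le le_rfl) hbd
  have hd : 0 ≤ Metric.diam (between Q a b) := Metric.diam_nonneg
  by_cases hc : (b - a) / 4 ≤ w - a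
  · nlinarith
  · have h2 := hQ.two_mul_le ha hb ⟨w, hwI⟩
    have hright : ∀ z ∈ between Q w b, b - z ≤ w - a := by
      intro z hz
      have h1 := hmax z (between_subset haw.le le_rfl hz)
      have h3 := min_le_left (w - a) (b - w)
      rcases min_le_iff.1 (h1.trans h3) with h | h
      · linarith [hz.2.1]
      · exact h
    have hsmall : Metric.diam (between Q w b) ≤ (b - a) / 4 := by
      refine Metric.diam_le_of_forall_dist_le (by linarith) fun s hs t ht => ?_
      have h3 := hright s hs
      have h4 := hright t ht
      have h5 := hs.2.2
      have h6 := ht.2.2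
      rw [Real.dist_eq, abs_le]
      constructor <;> linarith
    obtain ⟨z, hz⟩ := hne
    have hbig : (b - a) / 2 ≤ Metric.diam (between Q a b) := by
      refine le_trans ?_ (Metric.dist_le_diam_of_mem hbd (between_subset haw.le le_rfl hz) hwI)
      rw [Real.dist_eq]
      refine le_trans ?_ (le_abs_self _)
      linarith [hright z hz]
    have h7 : Metric.diam (between Q w b) + δ ≤ 3 / 4 * (Metric.diam (between Q a b) + δ) := by
      linarith
    have h8 : 0 ≤ Metric.diam (between Q w b) := Metric.diam_nonneg
    nlinarith

/-- The mirror image of `Pool.cost_right`. -/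
theorem Pool.cost_left (hQ : Pool Q g pc k δ) (ha : a ∈ Q) (hb : b ∈ Q)
    (hw : IsCentral Q a b w) : cost Q δ a w ≤ cost Q δ a b - 1 := by
  obtain ⟨hwI, hmax⟩ := hw
  have hδ := hQ.pos
  obtain ⟨hwQ, haw, hwb⟩ := id hwI
  refine hQ.cost_le_sub_one ha hb ha hwQ ⟨w, hwI⟩ fun hne => ?_
  have hbd := isBounded_between Q a b
  have hmono : Metric.diam (between Q a w) ≤ Metric.diam (between Q a b) :=
    Metric.diam_mono (between_subset le_rfl hwb.le) hbd
  have hd : 0 ≤ Metric.diam (between Q a b) := Metric.diam_nonneg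
  by_cases hc : (b - a) / 4 ≤ b - w
  · nlinarith
  · have h2 := hQ.two_mul_le ha hb ⟨w, hwI⟩
    have hleft : ∀ z ∈ between Q a w, z - a ≤ b - w := by
      intro z hz
      have h1 := hmax z (between_subset le_rfl hwb.le hz)
      have h3 := min_le_right (w - a) (b - w)
      rcases min_le_iff.1 (h1.trans h3) with h | h
      · exact h
      · linarith [hz.2.2]
    have hsmall : Metric.diam (between Q a w) ≤ (b - a) / 4 := by
      refine Metric.diam_le_of_forall_dist_le (by linarith) fun s hs t ht => ?_
      have h3 := hleft s hs
      have h4 := hleft t ht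
      have h5 := hs.2.1
      have h6 := ht.2.1
      rw [Real.dist_eq, abs_le]
      constructor <;> linarith
    obtain ⟨z, hz⟩ := hne
    have hbig : (b - a) / 2 ≤ Metric.diam (between Q a b) := by
      refine le_trans ?_ (Metric.dist_le_diam_of_mem hbd hwI (between_subset le_rfl hwb.le hz))
      rw [Real.dist_eq]
      refine le_trans ?_ (le_abs_self _)
      linarith [hleft z hz]
    have h7 : Metric.diam (between Q a w) + δ ≤ 3 / 4 * (Metric.diam (between Q a b) + δ) := by
      linarith
    have h8 : 0 ≤ Metric.diam (between Q a w) := Metric.diam_nonneg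
    nlinarith

/-! ### Gaps with opposite labels and the potential. -/

open Classical in
/-- The gaps of `A` whose ends have different labels. -/
def oppGaps (A : Finset ℝ) (g : ℝ → ℝ) : Finset (ℝ × ℝ) :=
  (A ×ˢ A).filter fun p => IsGap A p.1 p.2 ∧ g p.1 ≠ g p.2

theorem mem_oppGaps {p : ℝ × ℝ} : p ∈ oppGaps A g ↔ IsGap A p.1 p.2 ∧ g p.1 ≠ g p.2 := by
  classical
  simp only [oppGaps, Finset.mem_filter, Finset.mem_product]
  exact ⟨fun h => h.2, fun h => ⟨⟨h.1.1, h.1.2.1⟩, h⟩⟩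

theorem isGap_insert_iff (hg : IsGap A a b) (haw : a < w) (hwb : w < b) {p q : ℝ} :
    IsGap (insert w A) p q ↔
      (IsGap A p q ∧ (p, q) ≠ (a, b)) ∨ (p, q) = (a, w) ∨ (p, q) = (w, b) := by
  obtain ⟨ha, hb, hab, hsep⟩ := hg
  constructor
  · rintro ⟨hp, hq, hpq, h⟩
    have hA : ∀ r ∈ A, r ≤ p ∨ q ≤ r := fun r hr => h r (Finset.mem_insert_of_mem hr)
    rcases Finset.mem_insert.1 hp with rfl | hp'
    · right; right
      rcases Finset.mem_insert.1 hq with rfl | hq'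
      · exact absurd hpq (lt_irrefl _)
      have h1 := (hA b hb).resolve_left hwb.not_ge
      have h2 : b ≤ q := (hsep q hq').resolve_left (by linarith)
      rw [le_antisymm h1 h2]
    · rcases Finset.mem_insert.1 hq with rfl | hq'
      · right; left
        have h1 := (hA a ha).resolve_right haw.not_ge
        have h2 : p ≤ a := (hsep p hp').resolve_right (by linarith)
        rw [le_antisymm h1 h2]
      · left
        refine ⟨⟨hp', hq', hpq, hA⟩, fun he => ?_⟩
        obtain ⟨rfl, rfl⟩ := Prod.ext_iff.1 he
        rcases h w (Finset.mem_insert_self _ _) with h | h <;> linarith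
  · rintro (⟨⟨hp, hq, hpq, h⟩, hne⟩ | he | he)
    · refine ⟨Finset.mem_insert_of_mem hp, Finset.mem_insert_of_mem hq, hpq, fun r hr => ?_⟩
      rcases Finset.mem_insert.1 hr with rfl | hr
      · by_contra hc
        push Not at hc
        have h1 := (h a ha).resolve_right (by linarith)
        have h2 := (h b hb).resolve_left (by linarith)
        have h3 := (hsep p hp).resolve_right (by linarith)
        have h4 := (hsep q hq).resolve_left (by linarith)
        exact hne (by rw [le_antisymm h1 h3, le_antisymm h2 h4])
      · exact h r hr
    · obtain ⟨rfl, rfl⟩ := Prod.ext_iff.1 he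
      refine ⟨by simp [ha], by simp, haw, fun r hr => ?_⟩
      rcases Finset.mem_insert.1 hr with rfl | hr
      · exact Or.inr le_rfl
      · exact (hsep r hr).imp_right fun h => hwb.le.trans h
    · obtain ⟨rfl, rfl⟩ := Prod.ext_iff.1 he
      refine ⟨by simp, by simp [hb], hwb, fun r hr => ?_⟩
      rcases Finset.mem_insert.1 hr with rfl | hr
      · exact Or.inl le_rfl
      · exact (hsep r hr).imp_left fun h => h.trans haw.le

theorem not_mem_oppGaps_left (hg : IsGap A a b) (haw : a < w) (hwb : w < b) :
    (a, w) ∉ oppGaps A g ∧ (w, b) ∉ oppGaps A g := by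
  have hw : w ∉ A := fun h => by rcases hg.2.2.2 w h with h | h <;> linarith
  exact ⟨fun h => hw (mem_oppGaps.1 h).1.2.1, fun h => hw (mem_oppGaps.1 h).1.1⟩

/-- Upper bound for the number of bisections still to be made. -/
def potential (Q A : Finset ℝ) (g : ℝ → ℝ) (k : ℕ) (δ : ℝ) : ℝ :=
  -- Each of the `k` possible gaps with opposite labels is charged `maxCost δ` in advance, so the
  -- discovery of a new one cannot raise the potential.
  k * maxCost δ + ∑ p ∈ oppGaps A g, (cost Q δ p.1 p.2 - maxCost δ)

/-- The piece of the right end determines the gap. If two right ends lay in one piece, the later gap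
would lie wholly in that piece and have equal labels. -/
theorem Pool.card_oppGaps_le (hQ : Pool Q g pc k δ) (hA : A ⊆ Q) :
    (oppGaps A g).card ≤ k := by
  rw [← Finset.card_range k]
  refine Finset.card_le_card_of_injOn (fun p => pc p.2) ?_ ?_
  · intro p hp
    have := mem_oppGaps.1 (Finset.mem_coe.1 hp)
    simpa using hQ.pc_lt _ (hA this.1.2.1)
  · have key : ∀ p ∈ oppGaps A g, ∀ q ∈ oppGaps A g, pc p.2 = pc q.2 → ¬ p.2 < q.2 := by
      intro p hp q hq hpq hlt
      obtain ⟨⟨hp1, hp2, hp3, hp4⟩, hp5⟩ := mem_oppGaps.1 hp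
      obtain ⟨⟨hq1, hq2, hq3, hq4⟩, hq5⟩ := mem_oppGaps.1 hq
      have h1 : p.2 ≤ q.1 := (hq4 _ hp2).resolve_right (by linarith)
      have h2 := hQ.pc_mono _ (hA hp2) _ (hA hq1) h1
      have h3 := hQ.pc_mono _ (hA hq1) _ (hA hq2) hq3.le
      exact hq5 (hQ.pc_const _ (hA hq1) _ (hA hq2) (by omega))
    intro p hp q hq hpq
    have h2 : p.2 = q.2 := le_antisymm (not_lt.1 (key q hq p hp hpq.symm))
      (not_lt.1 (key p hp q hq hpq))
    obtain ⟨⟨hp1, hp2, hp3, hp4⟩, -⟩ := mem_oppGaps.1 hp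
    obtain ⟨⟨hq1, hq2, hq3, hq4⟩, -⟩ := mem_oppGaps.1 hq
    have h1 : p.1 = q.1 := by
      have := (hp4 q.1 hq1).resolve_right (by linarith)
      have := (hq4 p.1 hp1).resolve_right (by linarith)
      linarith
    exact Prod.ext h1 h2

theorem Pool.potential_nonneg (hQ : Pool Q g pc k δ) (hA : A ⊆ Q) :
    0 ≤ potential Q A g k δ := by
  have h1 : ∑ p ∈ oppGaps A g, (-maxCost δ)
      ≤ ∑ p ∈ oppGaps A g, (cost Q δ p.1 p.2 - maxCost δ) := by
    refine Finset.sum_le_sum fun p hp => ?_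
    have := mem_oppGaps.1 hp
    linarith [hQ.cost_nonneg (hA this.1.1) (hA this.1.2.1)]
  rw [Finset.sum_const, nsmul_eq_mul] at h1
  have h2 : ((oppGaps A g).card : ℝ) ≤ k := by exact_mod_cast hQ.card_oppGaps_le hA
  have h3 := mul_le_mul_of_nonneg_right h2 hQ.maxCost_nonneg
  unfold potential
  linarith

theorem Pool.potential_le (hQ : Pool Q g pc k δ) (hA : A ⊆ Q) :
    potential Q A g k δ ≤ k * maxCost δ := by
  have : ∑ p ∈ oppGaps A g, (cost Q δ p.1 p.2 - maxCost δ) ≤ 0 := by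
    refine Finset.sum_nonpos fun p hp => ?_
    have := mem_oppGaps.1 hp
    linarith [hQ.cost_le (hA this.1.1) (hA this.1.2.1)]
  unfold potential
  linarith

theorem oppGaps_insert_of_eq (hg : IsGap A a b) (haw : a < w) (hwb : w < b) (hab : g a = g b)
    (hw : g w = g a) : oppGaps (insert w A) g = oppGaps A g := by
  ext ⟨p, q⟩
  rw [mem_oppGaps, mem_oppGaps, isGap_insert_iff hg haw hwb]
  constructor
  · rintro ⟨⟨h, -⟩ | h | h, hne⟩
    · exact ⟨h, hne⟩
    all_goals
      obtain ⟨rfl, rfl⟩ := Prod.ext_iff.1 h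
      simp_all
  · rintro ⟨h, hne⟩
    refine ⟨Or.inl ⟨h, fun he => ?_⟩, hne⟩
    obtain ⟨rfl, rfl⟩ := Prod.ext_iff.1 he
    exact hne hab

theorem oppGaps_insert_of_ne (hg : IsGap A a b) (haw : a < w) (hwb : w < b) (hab : g a = g b)
    (hw : g w ≠ g a) : oppGaps (insert w A) g = insert (a, w) (insert (w, b) (oppGaps A g)) := by
  ext ⟨p, q⟩
  rw [Finset.mem_insert, Finset.mem_insert, mem_oppGaps, mem_oppGaps,
    isGap_insert_iff hg haw hwb]
  constructor
  · rintro ⟨⟨h, -⟩ | h | h, hne⟩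
    · exact Or.inr (Or.inr ⟨h, hne⟩)
    · exact Or.inl h
    · exact Or.inr (Or.inl h)
  · rintro (h | h | ⟨h, hne⟩)
    · refine ⟨Or.inr (Or.inl h), ?_⟩
      obtain ⟨rfl, rfl⟩ := Prod.ext_iff.1 h
      exact hw.symm
    · refine ⟨Or.inr (Or.inr h), ?_⟩
      obtain ⟨rfl, rfl⟩ := Prod.ext_iff.1 h
      exact hab ▸ hw
    · refine ⟨Or.inl ⟨h, fun he => ?_⟩, hne⟩
      obtain ⟨rfl, rfl⟩ := Prod.ext_iff.1 he
      exact hne hab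

theorem oppGaps_insert_of_left (hg : IsGap A a b) (haw : a < w) (hwb : w < b) (hab : g a ≠ g b)
    (hw : g w = g a) :
    oppGaps (insert w A) g = insert (w, b) ((oppGaps A g).erase (a, b)) := by
  ext ⟨p, q⟩
  rw [Finset.mem_insert, Finset.mem_erase, mem_oppGaps, mem_oppGaps, isGap_insert_iff hg haw hwb]
  constructor
  · rintro ⟨⟨h, hne⟩ | h | h, hpq⟩
    · exact Or.inr ⟨hne, h, hpq⟩
    · obtain ⟨rfl, rfl⟩ := Prod.ext_iff.1 h
      exact absurd hw.symm hpq
    · exact Or.inl h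
  · rintro (h | ⟨hne, h, hpq⟩)
    · refine ⟨Or.inr (Or.inr h), ?_⟩
      obtain ⟨rfl, rfl⟩ := Prod.ext_iff.1 h
      exact hw ▸ hab
    · exact ⟨Or.inl ⟨h, hne⟩, hpq⟩

theorem oppGaps_insert_of_right (hg : IsGap A a b) (haw : a < w) (hwb : w < b) (hab : g a ≠ g b)
    (hw : g w = g b) :
    oppGaps (insert w A) g = insert (a, w) ((oppGaps A g).erase (a, b)) := by
  ext ⟨p, q⟩
  rw [Finset.mem_insert, Finset.mem_erase, mem_oppGaps, mem_oppGaps, isGap_insert_iff hg haw hwb]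
  constructor
  · rintro ⟨⟨h, hne⟩ | h | h, hpq⟩
    · exact Or.inr ⟨hne, h, hpq⟩
    · exact Or.inl h
    · obtain ⟨rfl, rfl⟩ := Prod.ext_iff.1 h
      exact absurd hw hpq
  · rintro (h | ⟨hne, h, hpq⟩)
    · refine ⟨Or.inr (Or.inl h), ?_⟩
      obtain ⟨rfl, rfl⟩ := Prod.ext_iff.1 h
      exact fun he => hab (he.trans hw)
    · exact ⟨Or.inl ⟨h, hne⟩, hpq⟩

/-- An unexpected label opens two gaps with opposite labels, and each adds `cost - maxCost ≤ 0`. -/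
theorem Pool.potential_insert_same (hQ : Pool Q g pc k δ) (hA : A ⊆ Q) (hg : IsGap A a b)
    (hwQ : w ∈ Q) (haw : a < w) (hwb : w < b) (hab : g a = g b) :
    potential Q (insert w A) g k δ ≤ potential Q A g k δ := by
  unfold potential
  by_cases hw : g w = g a
  · rw [oppGaps_insert_of_eq hg haw hwb hab hw]
  · obtain ⟨h1, h2⟩ := not_mem_oppGaps_left (g := g) hg haw hwb
    rw [oppGaps_insert_of_ne hg haw hwb hab hw, Finset.sum_insert, Finset.sum_insert h2]
    · have := hQ.cost_le (hA hg.1) hwQ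
      have := hQ.cost_le hwQ (hA hg.2.1)
      simp only
      linarith
    · rw [Finset.mem_insert, not_or]
      refine ⟨fun h => ?_, h1⟩
      have := (Prod.ext_iff.1 h).1
      simp only at this
      linarith

/-- The label of `w` agrees with exactly one end, so exactly one of the two new gaps has opposite
labels, and its cost is smaller by at least `1`. -/
theorem Pool.potential_insert_opp (hQ : Pool Q g pc k δ) (hA : A ⊆ Q) (hg : IsGap A a b)
    (hab : g a ≠ g b) (hw : IsCentral Q a b w) :
    potential Q (insert w A) g k δ ≤ potential Q A g k δ - 1 := by
  have haw := hw.1.2.1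
  have hwb := hw.1.2.2
  have hmem : (a, b) ∈ oppGaps A g := mem_oppGaps.2 ⟨hg, hab⟩
  obtain ⟨h1, h2⟩ := not_mem_oppGaps_left (g := g) hg haw hwb
  have hl := hQ.cost_left (hA hg.1) (hA hg.2.1) hw
  have hr := hQ.cost_right (hA hg.1) (hA hg.2.1) hw
  have hcase : g w = g a ∨ g w = g b := by
    rcases hQ.label w hw.1.1 with h | h <;> rcases hQ.label a (hA hg.1) with h' | h' <;>
      rcases hQ.label b (hA hg.2.1) with h'' | h'' <;> rw [h', h''] at hab <;>
      rw [h, h', h''] <;> simp_all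
  unfold potential
  rw [← Finset.add_sum_erase _ _ hmem]
  rcases hcase with h | h
  · rw [oppGaps_insert_of_left hg haw hwb hab h,
      Finset.sum_insert fun h => h2 (Finset.mem_of_mem_erase h)]
    simp only
    linarith
  · rw [oppGaps_insert_of_right hg haw hwb hab h,
      Finset.sum_insert fun h => h1 (Finset.mem_of_mem_erase h)]
    simp only
    linarith

/-! ### Pending bisections and pieces without a label. -/

/-- Some gap of `A` with different labels at its ends still contains points of the pool. -/
def Active (Q A : Finset ℝ) (g : ℝ → ℝ) : Prop :=
  ∃ p ∈ oppGaps A g, (between Q p.1 p.2).Nonempty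

/-- The pieces without a labeled point. -/
def unhit (A : Finset ℝ) (pc : ℝ → ℕ) (k : ℕ) : Finset ℕ :=
  (Finset.range k).filter fun j => ∀ z ∈ A, pc z ≠ j

theorem unhit_insert (w : ℝ) : unhit (insert w A) pc k = (unhit A pc k).erase (pc w) := by
  ext j
  simp only [unhit, Finset.mem_filter, Finset.mem_erase, Finset.forall_mem_insert]
  tauto

/-- In a gap with equal labels at its ends, points of pieces that have been hit carry the same
label. -/
theorem Pool.label_eq_of_hit (hQ : Pool Q g pc k δ) (hA : A ⊆ Q) (hg : IsGap A a b)
    (hab : g a = g b) (hw : w ∈ between Q a b) (hit : pc w ∉ unhit A pc k) : g w = g a := by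
  obtain ⟨hwQ, haw, hwb⟩ := hw
  have : ∃ z ∈ A, pc z = pc w := by
    by_contra hc
    push Not at hc
    exact hit (Finset.mem_filter.2 ⟨Finset.mem_range.2 (hQ.pc_lt w hwQ), hc⟩)
  obtain ⟨z, hz, hzw⟩ := this
  have h1 := hQ.pc_mono a (hA hg.1) w hwQ haw.le
  have h2 := hQ.pc_mono w hwQ b (hA hg.2.1) hwb.le
  rcases hg.2.2.2 z hz with h | h
  · have h3 := hQ.pc_mono z (hA hz) a (hA hg.1) h
    exact hQ.pc_const w hwQ a (hA hg.1) (by omega)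
  · have h3 := hQ.pc_mono b (hA hg.2.1) z (hA hz) h
    rw [hab]
    exact hQ.pc_const w hwQ b (hA hg.2.1) (by omega)

theorem eq_of_not_active (hn : ¬ Active Q A g) (hg : IsGap A a b) (hw : w ∈ between Q a b) :
    g a = g b := by
  by_contra hab
  exact hn ⟨(a, b), mem_oppGaps.2 ⟨hg, hab⟩, w, hw⟩

/-- A point from a piece already hit has the label of both ends of its gap and creates nothing to
bisect. Only a new piece can restart the bisection. -/
theorem Pool.not_active_insert (hQ : Pool Q g pc k δ) (hA : A ⊆ Q) (hn : ¬ Active Q A g)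
    (hg : IsGap A a b) (hw : w ∈ between Q a b) (hit : pc w ∉ unhit A pc k) :
    ¬ Active Q (insert w A) g := by
  have hab := eq_of_not_active hn hg hw
  unfold Active
  rwa [oppGaps_insert_of_eq hg hw.2.1 hw.2.2 hab (hQ.label_eq_of_hit hA hg hab hw hit)]

end

/-! ### The labeled indices as a Markov chain. -/

theorem labeledData_eq {N : ℕ} (g : ℝ → ℝ) (x : Fin N → ℝ) (S : Finset (Fin N)) :
    labeledData g x S = graph (S.image x) g := by
  rw [labeledData, graph, Finset.image_image]
  rfl

section

variable {N H : ℕ} {g : ℝ → ℝ} {x : Fin N → ℝ} {S : Finset (Fin N)} {cr : Criterion}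

theorem mem_initialSet {i : Fin N} :
    i ∈ initialSet x ↔ (∀ j, x i ≤ x j) ∨ ∀ j, x j ≤ x i := by
  classical
  simp [initialSet]

theorem exists_extremes (hN : 2 ≤ N) (hx : Function.Injective x) :
    ∃ l ∈ initialSet x, ∃ r ∈ initialSet x, x l < x r ∧ ∀ i, x l ≤ x i ∧ x i ≤ x r := by
  have : Nonempty (Fin N) := ⟨⟨0, by omega⟩⟩
  obtain ⟨l, hl⟩ := Finite.exists_min x
  obtain ⟨r, hr⟩ := Finite.exists_max x
  refine ⟨l, mem_initialSet.2 (Or.inl hl), r, mem_initialSet.2 (Or.inr hr), ?_,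
    fun i => ⟨hl i, hr i⟩⟩
  by_contra hc
  have h : ∀ i, x i = x l := fun i => le_antisymm ((hr i).trans (not_lt.1 hc)) (hl i)
  have := hx ((h ⟨0, by omega⟩).trans (h ⟨1, by omega⟩).symm)
  simp at this

theorem enclosed_of_initialSet_subset (hN : 2 ≤ N) (hx : Function.Injective x)
    (hS : initialSet x ⊆ S) : Enclosed (S.image x) := by
  obtain ⟨l, hl, r, hr, hlr, h⟩ := exists_extremes hN hx
  refine ⟨x l, Finset.mem_image_of_mem _ (hS hl), x r, Finset.mem_image_of_mem _ (hS hr), hlr, ?_⟩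
  intro p hp
  obtain ⟨i, -, rfl⟩ := Finset.mem_image.1 hp
  exact h i

theorem mem_image_iff_of_injective (hx : Function.Injective x) {i : Fin N} :
    x i ∈ S.image x ↔ i ∈ S := by
  rw [Finset.mem_image]
  exact ⟨fun ⟨j, hj, hji⟩ => hx hji ▸ hj, fun h => ⟨i, h, rfl⟩⟩

theorem exists_gap_of_notMem (hN : 2 ≤ N) (hx : Function.Injective x)
    (hS : initialSet x ⊆ S) {i : Fin N} (hi : i ∉ S) :
    ∃ a b, IsGap (S.image x) a b ∧ x i ∈ between (Finset.univ.image x) a b := by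
  obtain ⟨l, hl, r, hr, hlr, h⟩ := exists_extremes hN hx
  have hil : x l ≠ x i := fun he => hi (hx he ▸ hS hl)
  have hir : x i ≠ x r := fun he => hi (hx he ▸ hS hr)
  obtain ⟨a, b, hg, ha, hb⟩ := exists_isGap (X := S.image x)
    (Finset.mem_image_of_mem _ (hS hl)) (Finset.mem_image_of_mem _ (hS hr))
    (lt_of_le_of_ne (h i).1 hil) (lt_of_le_of_ne (h i).2 hir)
    (fun h => hi ((mem_image_iff_of_injective hx).1 h))
  exact ⟨a, b, hg, by simp, ha, hb⟩

theorem notMem_of_mem_between {a b : ℝ}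
    (hg : IsGap (S.image x) a b) {i : Fin N} (hi : x i ∈ between (Finset.univ.image x) a b) :
    i ∉ S := by
  intro h
  rcases hg.2.2.2 _ (Finset.mem_image_of_mem x h) with h | h
  · exact absurd hi.2.1 h.not_gt
  · exact absurd hi.2.2 h.not_gt

theorem card_image_add_one_le (hx : Function.Injective x) (hNH : N ≤ H) {i : Fin N}
    (hi : i ∉ S) : (S.image x).card + 1 ≤ H := by
  rw [Finset.card_image_of_injective _ hx, ← Finset.card_insert_of_notMem hi]
  exact (Finset.card_le_univ _).trans (by simpa using hNH)

theorem sign_eq_of_label {z : ℝ} (h : g z = 1 ∨ g z = -1) : Real.sign (g z) = g z := by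
  rcases h with h | h <;> rw [h]
  · exact Real.sign_one
  · exact Real.sign_of_neg (by norm_num)

/-- The training error vanishes if every unlabeled point lies in a gap whose ends have the label
of that point. -/
theorem zeroTrainingError_of_gaps (hN : 2 ≤ N) (hx : Function.Injective x) (hNH : N ≤ H)
    (hlab : ∀ i, g (x i) = 1 ∨ g (x i) = -1) (hS : initialSet x ⊆ S)
    (h : ∀ i, i ∉ S → ∃ a b, IsGap (S.image x) a b ∧ a < x i ∧ x i < b ∧ g a = g b ∧
      g (x i) = g a) : ZeroTrainingError H g x S := by
  have henc := enclosed_of_initialSet_subset hN hx hS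
  obtain ⟨d, c, hs⟩ := exists_isSpline henc g
  obtain ⟨l, hl, -⟩ := henc
  have hy : ∀ p ∈ S.image x, g p = 1 ∨ g p = -1 := by
    intro p hp
    obtain ⟨i, -, rfl⟩ := Finset.mem_image.1 hp
    exact hlab i
  have hc : (S.image x).card ≤ H :=
    Finset.card_image_le.trans ((Finset.card_le_univ _).trans (by simpa using hNH))
  intro i
  rw [labeledData_eq, minNormFun_graph ⟨l, hl⟩ hs hy hc]
  by_cases hi : i ∈ S
  · rw [hs.interp _ (Finset.mem_image_of_mem _ hi), sign_eq_of_label (hlab i)]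
  · obtain ⟨a, b, hg, hai, hib, hab, hia⟩ := h i hi
    rw [hs.eq_on_gap hg ⟨hai.le, hib.le⟩, ← hab, sub_self, zero_mul, add_zero, ← hia,
      sign_eq_of_label (hlab i)]

theorem mem_maximizers {i : Fin N} : i ∈ maximizers cr H g x S ↔ i ∉ S ∧
    ∀ j, j ∉ S → score cr H (labeledData g x S) (x j) ≤ score cr H (labeledData g x S) (x i) := by
  classical
  simp [maximizers]

theorem maximizers_nonempty {i : Fin N} (hi : i ∉ S) : (maximizers cr H g x S).Nonempty := by
  obtain ⟨m, hm, hmax⟩ := Finset.exists_max_image (Sᶜ)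
    (fun j => score cr H (labeledData g x S) (x j)) ⟨i, Finset.mem_compl.2 hi⟩
  exact ⟨m, mem_maximizers.2 ⟨Finset.mem_compl.1 hm, fun j hj => hmax j (Finset.mem_compl.2 hj)⟩⟩

/-- The expectation after one step is an average over the maximizers. -/
theorem tsum_step (hM : (maximizers cr H g x S).Nonempty) (W : Finset (Fin N) → ℝ≥0∞) :
    ∑' T, step cr H g x S T * W T
      = ∑ i ∈ maximizers cr H g x S, ((maximizers cr H g x S).card : ℝ≥0∞)⁻¹ * W (insert i S) := by
  have h1 : ∀ T, step cr H g x S T * W T = ∑' i : Fin N,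
      (PMF.uniformOfFinset (maximizers cr H g x S) hM) i * (if T = insert i S then W T else 0) := by
    intro T
    rw [step, dif_pos hM, PMF.map_apply, ← ENNReal.tsum_mul_right]
    refine tsum_congr fun i => ?_
    split_ifs <;> simp
  simp_rw [h1]
  rw [ENNReal.tsum_comm]
  simp_rw [ENNReal.tsum_mul_left, tsum_ite_eq]
  rw [tsum_fintype, ← Finset.sum_subset (Finset.subset_univ (maximizers cr H g x S))]
  · refine Finset.sum_congr rfl fun i hi => ?_
    rw [PMF.uniformOfFinset_apply_of_mem _ hi]
  · intro i _ hi
    rw [PMF.uniformOfFinset_apply_of_notMem _ hi, zero_mul]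

/-- A drift inequality for one step yields exponential decay along the run. -/
theorem tsum_run_le (W : Finset (Fin N) → ℝ≥0∞) (q : ℝ≥0∞)
    (hW : ∀ S, ∑' T, step cr H g x S T * W T ≤ q * W S) (t : ℕ) :
    ∑' S, run cr H g x t S * W S ≤ q ^ t * W (initialSet x) := by
  induction t with
  | zero =>
    rw [run, pow_zero, one_mul]
    refine (tsum_eq_single (initialSet x) fun S hS => ?_).le.trans ?_
    · rw [PMF.pure_apply, if_neg hS, zero_mul]
    · rw [PMF.pure_apply, if_pos rfl, one_mul]
  | succ t ih =>
    calc ∑' S, run cr H g x (t + 1) S * W S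
        = ∑' T, run cr H g x t T * ∑' S, step cr H g x T S * W S := by
          simp_rw [run, PMF.bind_apply, ← ENNReal.tsum_mul_right]
          rw [ENNReal.tsum_comm]
          simp_rw [mul_assoc, ENNReal.tsum_mul_left]
      _ ≤ ∑' T, run cr H g x t T * (q * W T) :=
          ENNReal.tsum_le_tsum fun T => mul_le_mul_right (hW T) _
      _ = q * ∑' T, run cr H g x t T * W T := by
          rw [← ENNReal.tsum_mul_left]
          exact tsum_congr fun T => by ring
      _ ≤ q * (q ^ t * W (initialSet x)) := mul_le_mul_right ih _
      _ = q ^ (t + 1) * W (initialSet x) := by ring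

/-- Markov's inequality in the form needed for the run. -/
theorem ofReal_le_toOuterMeasure {α : Type*} (p : PMF α) (s : Set α) (W : α → ℝ≥0∞)
    (hW : ∀ a ∉ s, 1 ≤ W a) {ε : ℝ} (hε : 0 ≤ ε) (h : ∑' a, p a * W a ≤ ENNReal.ofReal ε) :
    ENNReal.ofReal (1 - ε) ≤ p.toOuterMeasure s := by
  rw [ENNReal.ofReal_sub _ hε, ENNReal.ofReal_one, tsub_le_iff_right,
    PMF.toOuterMeasure_apply]
  refine le_trans ?_ (add_le_add_right h _)
  rw [← p.tsum_coe, ← ENNReal.tsum_add]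
  refine ENNReal.tsum_le_tsum fun a => ?_
  by_cases ha : a ∈ s
  · rw [Set.indicator_of_mem ha]
    exact le_self_add
  · rw [Set.indicator_of_notMem ha, zero_add]
    exact le_mul_of_one_le_right' (hW a ha)

theorem support_run (hN : 2 ≤ N) (hx : Function.Injective x) (t : ℕ) :
    ∀ S ∈ (run cr H g x t).support, initialSet x ⊆ S ∧ min N (t + 2) ≤ S.card := by
  induction t with
  | zero =>
    intro S hS
    rw [run, PMF.mem_support_pure_iff] at hS
    subst hS
    refine ⟨subset_rfl, ?_⟩
    obtain ⟨l, hl, r, hr, hlr, -⟩ := exists_extremes hN hx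
    have : 1 < (initialSet x).card :=
      Finset.one_lt_card.2 ⟨l, hl, r, hr, fun h => hlr.ne (by rw [h])⟩
    omega
  | succ t ih =>
    intro S hS
    rw [run, PMF.mem_support_bind_iff] at hS
    obtain ⟨T, hT, hS⟩ := hS
    obtain ⟨h1, h2⟩ := ih T hT
    by_cases hM : (maximizers cr H g x T).Nonempty
    · rw [step, dif_pos hM, PMF.mem_support_map_iff] at hS
      obtain ⟨i, hi, rfl⟩ := hS
      rw [PMF.mem_support_uniformOfFinset_iff] at hi
      refine ⟨h1.trans (Finset.subset_insert _ _), ?_⟩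
      have := Finset.card_insert_of_notMem (mem_maximizers.1 hi).1
      omega
    · rw [step, dif_neg hM, PMF.mem_support_pure_iff] at hS
      subst hS
      refine ⟨h1, ?_⟩
      have : S = Finset.univ := by
        by_contra hc
        obtain ⟨i, hi⟩ : ∃ i, i ∉ S := by
          by_contra hc'
          push Not at hc'
          exact hc (Finset.eq_univ_iff_forall.2 hc')
        exact hM (maximizers_nonempty hi)
      rw [this, Finset.card_univ, Fintype.card_fin]
      exact min_le_left _ _

/-- Once `N` labels have been requested, all points are labeled. -/
theorem toOuterMeasure_run_of_le (hN : 2 ≤ N) (hx : Function.Injective x) (hNH : N ≤ H)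
    (hlab : ∀ i, g (x i) = 1 ∨ g (x i) = -1) {t : ℕ} (ht : N ≤ t + 2) :
    (run cr H g x t).toOuterMeasure {S | ZeroTrainingError H g x S} = 1 := by
  rw [PMF.toOuterMeasure_apply_eq_one_iff]
  intro S hS
  obtain ⟨h1, h2⟩ := support_run hN hx t S hS
  have hu : S = Finset.univ := Finset.eq_univ_of_card _ (le_antisymm (Finset.card_le_univ _)
    (by rw [Fintype.card_fin]; omega))
  refine zeroTrainingError_of_gaps hN hx hNH hlab h1 fun i hi => ?_
  rw [hu] at hi
  exact absurd (Finset.mem_univ i) hi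

end

/-! ### Drift of the algorithm on a fixed pool. -/

section

variable {N H k : ℕ} {g : ℝ → ℝ} {pc : ℝ → ℕ} {δ : ℝ} {x : Fin N → ℝ} {S : Finset (Fin N)}
  {cr : Criterion}

theorem image_subset_pool : S.image x ⊆ Finset.univ.image x :=
  Finset.image_subset_image (Finset.subset_univ S)

theorem Pool.label_image (hQ : Pool (Finset.univ.image x) g pc k δ) (i : Fin N) :
    g (x i) = 1 ∨ g (x i) = -1 := hQ.label _ (by simp)

/-- The score of an unlabeled point in either kind of gap. -/
theorem Pool.score_cases (hQ : Pool (Finset.univ.image x) g pc k δ) (hN : 2 ≤ N)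
    (hx : Function.Injective x) (hNH : N ≤ H) (hS : initialSet x ⊆ S) {j : Fin N} (hj : j ∉ S) :
    ∃ e : ℝ, 0 ≤ e ∧ ∀ i ∉ S, ∀ a b, IsGap (S.image x) a b →
      x i ∈ between (Finset.univ.image x) a b →
      (g a = g b → score cr H (labeledData g x S) (x i) = baseScore cr H (labeledData g x S)) ∧
      (g a ≠ g b → score cr H (labeledData g x S) (x i)
        = oppScore cr e (b - a) (min (x i - a) (b - x i)) ∧
        baseScore cr H (labeledData g x S) < score cr H (labeledData g x S) (x i)) := by
  have henc := enclosed_of_initialSet_subset hN hx hS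
  obtain ⟨d, c, hs⟩ := exists_isSpline henc g
  obtain ⟨l, hl, -⟩ := henc
  have hy : ∀ p ∈ S.image x, g p = 1 ∨ g p = -1 := fun p hp => hQ.label p (image_subset_pool hp)
  have hH := card_image_add_one_le hx hNH hj
  refine ⟨_, hs.energy_nonneg hy, fun i hi a b hg hib => ⟨fun hab => ?_, fun hab => ?_⟩⟩
  · rw [labeledData_eq]
    exact score_of_same cr hs hy hH hg hib.2.1 hib.2.2 hab
  · rw [labeledData_eq]
    have := score_of_opp cr hs hy hH hg hib.2.1 hib.2.2
      (hQ.mem_unit a (image_subset_pool hg.1)).1 (hQ.mem_unit b (image_subset_pool hg.2.1)).2 hab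
    refine ⟨this, ?_⟩
    rw [this]
    have h1 := hib.2.1
    have h2 := hib.2.2
    exact baseScore_lt_oppScore hs ⟨l, hl⟩ hy hH (lt_min (by linarith) (by linarith))
      ((min_le_left _ _).trans_lt (by linarith))

/-- As long as there is a choice, a point of largest score bisects a gap with different labels. -/
theorem Pool.isCentral_of_mem_maximizers (hQ : Pool (Finset.univ.image x) g pc k δ) (hN : 2 ≤ N)
    (hx : Function.Injective x) (hNH : N ≤ H) (hS : initialSet x ⊆ S)
    (hact : Active (Finset.univ.image x) (S.image x) g) {i : Fin N}
    (hi : i ∈ maximizers cr H g x S) :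
    ∃ a b, IsGap (S.image x) a b ∧ g a ≠ g b ∧ IsCentral (Finset.univ.image x) a b (x i) := by
  obtain ⟨hiS, hmax⟩ := mem_maximizers.1 hi
  obtain ⟨e, he, hsc⟩ := hQ.score_cases (cr := cr) hN hx hNH hS hiS
  obtain ⟨p, hp, z, hz⟩ := hact
  obtain ⟨hpg, hpne⟩ := mem_oppGaps.1 hp
  obtain ⟨m, -, rfl⟩ := Finset.mem_image.1 hz.1
  have hmS := notMem_of_mem_between hpg hz
  -- The witness `m` of activity scores above the base value, hence so does the maximizer, which
  -- must then lie between opposite labels.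
  have h1 := ((hsc m hmS _ _ hpg hz).2 hpne).2.trans_le (hmax m hmS)
  obtain ⟨a, b, hg, hib⟩ := exists_gap_of_notMem hN hx hS hiS
  have hab : g a ≠ g b := fun hab => h1.ne' ((hsc i hiS a b hg hib).1 hab)
  refine ⟨a, b, hg, hab, hib, fun w hw => ?_⟩
  obtain ⟨j, -, rfl⟩ := Finset.mem_image.1 hw.1
  have hjS := notMem_of_mem_between hg hw
  have h2 := hmax j hjS
  rw [((hsc i hiS a b hg hib).2 hab).1, ((hsc j hjS a b hg hw).2 hab).1] at h2
  have h3 := hib.2.1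
  have h4 := hib.2.2
  have h5 := hw.2.1
  have h6 := hw.2.2
  exact oppScore_le_imp he (lt_min (by linarith) (by linarith))
    (le_min (by linarith) (by linarith)) ((min_le_left _ _).trans_lt (by linarith))
    ((min_le_left _ _).trans_lt (by linarith)) h2

/-- If no gap with different labels contains unlabeled points, all scores are equal. -/
theorem Pool.maximizers_eq_compl (hQ : Pool (Finset.univ.image x) g pc k δ) (hN : 2 ≤ N)
    (hx : Function.Injective x) (hNH : N ≤ H) (hS : initialSet x ⊆ S)
    (hact : ¬ Active (Finset.univ.image x) (S.image x) g) : maximizers cr H g x S = Sᶜ := by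
  ext i
  rw [mem_maximizers, Finset.mem_compl]
  refine ⟨fun h => h.1, fun hi => ⟨hi, fun j hj => ?_⟩⟩
  obtain ⟨e, he, hsc⟩ := hQ.score_cases (cr := cr) hN hx hNH hS hi
  have : ∀ m ∉ S, score cr H (labeledData g x S) (x m)
      = baseScore cr H (labeledData g x S) := by
    intro m hm
    obtain ⟨a, b, hg, hmb⟩ := exists_gap_of_notMem hN hx hS hm
    exact (hsc m hm a b hg hmb).1 (eq_of_not_active hact hg hmb)
  rw [this i hi, this j hj]

theorem Pool.zeroTrainingError (hQ : Pool (Finset.univ.image x) g pc k δ) (hN : 2 ≤ N)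
    (hx : Function.Injective x) (hNH : N ≤ H) (hS : initialSet x ⊆ S)
    (hact : ¬ Active (Finset.univ.image x) (S.image x) g) (hhit : unhit (S.image x) pc k = ∅) :
    ZeroTrainingError H g x S := by
  refine zeroTrainingError_of_gaps hN hx hNH hQ.label_image hS fun i hi => ?_
  obtain ⟨a, b, hg, hib⟩ := exists_gap_of_notMem hN hx hS hi
  have hab := eq_of_not_active hact hg hib
  exact ⟨a, b, hg, hib.2.1, hib.2.2, hab,
    hQ.label_eq_of_hit image_subset_pool hg hab hib (by simp [hhit])⟩

open Classical in
/-- The number of pieces without a label, plus one half if there is a gap to be bisected. -/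
def defect (g : ℝ → ℝ) (pc : ℝ → ℕ) (k : ℕ) (x : Fin N → ℝ) (S : Finset (Fin N)) : ℝ :=
  (unhit (S.image x) pc k).card +
    -- The weight is positive, so that a pending bisection counts as failure, and below `1`, so that
    -- hitting a new piece lowers the defect even if it starts a bisection.
    if Active (Finset.univ.image x) (S.image x) g then 1 / 2 else 0

/-- The Lyapunov function of the algorithm. -/
def lyapunov (g : ℝ → ℝ) (pc : ℝ → ℕ) (k : ℕ) (δ μ : ℝ) (x : Fin N → ℝ)
    (S : Finset (Fin N)) : ℝ :=
  defect g pc k x S *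
    Real.exp (μ * potential (Finset.univ.image x) (S.image x) g k δ)

theorem defect_nonneg : 0 ≤ defect g pc k x S := by
  classical
  unfold defect
  split_ifs <;> positivity

theorem lyapunov_nonneg {μ : ℝ} : 0 ≤ lyapunov g pc k δ μ x S :=
  mul_nonneg defect_nonneg (Real.exp_nonneg _)

theorem defect_le (g : ℝ → ℝ) (pc : ℝ → ℕ) (k : ℕ) (x : Fin N → ℝ) (S : Finset (Fin N)) :
    defect g pc k x S ≤ k + 1 / 2 := by
  have h : (unhit (S.image x) pc k).card ≤ k :=
    (Finset.card_filter_le _ _).trans (Finset.card_range k).le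
  have h' : ((unhit (S.image x) pc k).card : ℝ) ≤ k := by exact_mod_cast h
  unfold defect
  split_ifs <;> linarith

theorem defect_insert_le_of_active (hact : Active (Finset.univ.image x) (S.image x) g)
    (i : Fin N) : defect g pc k x (insert i S) ≤ defect g pc k x S := by
  unfold defect
  rw [Finset.image_insert, unhit_insert, if_pos hact]
  have h : (((unhit (S.image x) pc k).erase (pc (x i))).card : ℝ)
      ≤ (unhit (S.image x) pc k).card := by exact_mod_cast Finset.card_erase_le
  split_ifs <;> linarith

/-- Every maximizer is a bisection, so this contraction is deterministic: the potential drops by `1`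
while the defect does not grow. -/
theorem Pool.lyapunov_insert_of_active (hQ : Pool (Finset.univ.image x) g pc k δ) (hN : 2 ≤ N)
    (hx : Function.Injective x) (hNH : N ≤ H) (hS : initialSet x ⊆ S)
    (hact : Active (Finset.univ.image x) (S.image x) g) {μ : ℝ} (hμ : 0 ≤ μ) {i : Fin N}
    (hi : i ∈ maximizers cr H g x S) :
    lyapunov g pc k δ μ x (insert i S) ≤ Real.exp (-μ) * lyapunov g pc k δ μ x S := by
  obtain ⟨a, b, hg, hab, hc⟩ := hQ.isCentral_of_mem_maximizers hN hx hNH hS hact hi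
  have h := hQ.potential_insert_opp image_subset_pool hg hab hc
  have h' : Real.exp (μ * potential (Finset.univ.image x) ((insert i S).image x) g k δ)
      ≤ Real.exp (-μ) * Real.exp (μ * potential (Finset.univ.image x) (S.image x) g k δ) := by
    rw [← Real.exp_add, Real.exp_le_exp, Finset.image_insert]
    nlinarith
  unfold lyapunov
  calc _ ≤ defect g pc k x S * (Real.exp (-μ) *
        Real.exp (μ * potential (Finset.univ.image x) (S.image x) g k δ)) :=
        mul_le_mul (defect_insert_le_of_active hact i) h' (Real.exp_nonneg _) defect_nonneg
    _ = _ := by ring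

-- Hitting a new piece removes `1` and adds at most `1 / 2`. Hitting an old piece keeps the chain
-- inactive.
open Classical in
theorem Pool.defect_insert_of_not_active (hQ : Pool (Finset.univ.image x) g pc k δ) (hN : 2 ≤ N)
    (hx : Function.Injective x) (hS : initialSet x ⊆ S)
    (hact : ¬ Active (Finset.univ.image x) (S.image x) g) {i : Fin N} (hi : i ∉ S) :
    defect g pc k x (insert i S) ≤ (unhit (S.image x) pc k).card
      - if pc (x i) ∈ unhit (S.image x) pc k then 1 / 2 else 0 := by
  unfold defect
  rw [Finset.image_insert, unhit_insert]
  split_ifs with h1 h2 h2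
  · rw [← Finset.card_erase_add_one h2]
    push_cast
    linarith
  · obtain ⟨a, b, hg, hib⟩ := exists_gap_of_notMem hN hx hS hi
    exact absurd h1 (hQ.not_active_insert image_subset_pool hact hg hib h2)
  · rw [← Finset.card_erase_add_one h2]
    push_cast
    linarith
  · rw [Finset.erase_eq_of_notMem h2]
    linarith

/-- All points of a piece without a label are still unlabeled, so they can be counted piece by
piece. -/
theorem card_filter_unhit {c : ℝ}
    (hc : ∀ j < k, c * N ≤ (Finset.univ.filter fun i => pc (x i) = j).card) :
    (unhit (S.image x) pc k).card * (c * N)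
      ≤ ((Sᶜ).filter fun i => pc (x i) ∈ unhit (S.image x) pc k).card := by
  have h : ((Sᶜ).filter fun i => pc (x i) ∈ unhit (S.image x) pc k).card
      = ∑ j ∈ unhit (S.image x) pc k, (Finset.univ.filter fun i => pc (x i) = j).card := by
    rw [Finset.card_eq_sum_card_fiberwise (f := fun i => pc (x i))
      (t := unhit (S.image x) pc k)]
    · refine Finset.sum_congr rfl fun j hj => ?_
      congr 1
      ext i
      simp only [Finset.mem_filter, Finset.mem_compl, Finset.mem_univ, true_and]
      refine ⟨fun h => h.2, fun h => ⟨⟨fun hi => ?_, h ▸ hj⟩, h⟩⟩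
      exact (Finset.mem_filter.1 hj).2 _ (Finset.mem_image_of_mem x hi) h
    · intro i hi
      exact (Finset.mem_filter.1 (Finset.mem_coe.1 hi)).2
  rw [h]
  push_cast
  rw [← nsmul_eq_mul, ← Finset.sum_const]
  refine Finset.sum_le_sum fun j hj => hc j ?_
  exact Finset.mem_range.1 (Finset.mem_filter.1 hj).1

/-- Among the at most `N` unlabeled points, at least `m * c * N` lie in the `m` new pieces, and each
of these saves `1 / 2`. The average defect is thus at most `m * (1 - c / 2) ≤ m * exp (-μ)`, while
the potential does not rise. -/
theorem Pool.sum_lyapunov_of_not_active (hQ : Pool (Finset.univ.image x) g pc k δ) (hN : 2 ≤ N)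
    (hx : Function.Injective x) (hS : initialSet x ⊆ S)
    (hact : ¬ Active (Finset.univ.image x) (S.image x) g) {c μ : ℝ} (hμ : 0 ≤ μ)
    (hμc : μ ≤ c / 2)
    (hc : ∀ j < k, c * N ≤ (Finset.univ.filter fun i => pc (x i) = j).card) :
    ∑ i ∈ Sᶜ, lyapunov g pc k δ μ x (insert i S)
      ≤ (Sᶜ).card * (Real.exp (-μ) * lyapunov g pc k δ μ x S) := by
  classical
  set E := Real.exp (μ * potential (Finset.univ.image x) (S.image x) g k δ) with hE
  set m := ((unhit (S.image x) pc k).card : ℝ) with hm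
  have hm0 : 0 ≤ m := Nat.cast_nonneg _
  have hE0 : 0 ≤ E := Real.exp_nonneg _
  have hone : ∀ i ∈ Sᶜ, lyapunov g pc k δ μ x (insert i S)
      ≤ (m - if pc (x i) ∈ unhit (S.image x) pc k then 1 / 2 else 0) * E := by
    intro i hi
    rw [Finset.mem_compl] at hi
    have h1 := hQ.defect_insert_of_not_active hN hx hS hact hi
    obtain ⟨a, b, hg, hib⟩ := exists_gap_of_notMem hN hx hS hi
    have h2 := hQ.potential_insert_same image_subset_pool hg hib.1 hib.2.1 hib.2.2
      (eq_of_not_active hact hg hib)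
    have h3 : Real.exp (μ * potential (Finset.univ.image x) ((insert i S).image x) g k δ) ≤ E := by
      rw [hE, Real.exp_le_exp, Finset.image_insert]
      exact mul_le_mul_of_nonneg_left h2 hμ
    exact mul_le_mul h1 h3 (Real.exp_nonneg _) (defect_nonneg.trans h1)
  refine (Finset.sum_le_sum hone).trans ?_
  rw [← Finset.sum_mul, Finset.sum_sub_distrib, Finset.sum_const, nsmul_eq_mul,
    ← Finset.sum_filter, Finset.sum_const, nsmul_eq_mul]
  have h1 := card_filter_unhit (S := S) (x := x) hc
  rw [← hm] at h1
  have h2 : ((Sᶜ).card : ℝ) ≤ N := by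
    exact_mod_cast (Finset.card_le_univ _).trans (Fintype.card_fin N).le
  have hl : lyapunov g pc k δ μ x S = m * E := by
    rw [lyapunov, defect, if_neg hact, add_zero]
  have h3 : 1 - μ ≤ Real.exp (-μ) := by linarith [Real.add_one_le_exp (-μ)]
  rw [hl]
  have h4 : (Sᶜ).card * m - (((Sᶜ).filter fun i => pc (x i) ∈ unhit (S.image x) pc k).card : ℝ)
      * (1 / 2) ≤ (Sᶜ).card * (m * (1 - μ)) := by
    have h5 : m * (c * (Sᶜ).card) ≤ m * (c * N) :=
      mul_le_mul_of_nonneg_left (mul_le_mul_of_nonneg_left h2 (by linarith)) hm0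
    have h6 : μ * (m * (Sᶜ).card) ≤ c / 2 * (m * (Sᶜ).card) :=
      mul_le_mul_of_nonneg_right hμc (by positivity)
    linarith
  calc _ ≤ (Sᶜ).card * (m * (1 - μ)) * E := mul_le_mul_of_nonneg_right h4 hE0
    _ ≤ (Sᶜ).card * (m * Real.exp (-μ)) * E := by gcongr
    _ = _ := by ring

theorem average_le {ι : Type*} {M : Finset ι} (hM : M.Nonempty) {φ : ι → ℝ} {K : ℝ}
    (hφ : ∀ i ∈ M, 0 ≤ φ i) (h : ∑ i ∈ M, φ i ≤ M.card * K) :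
    ∑ i ∈ M, (M.card : ℝ≥0∞)⁻¹ * ENNReal.ofReal (φ i) ≤ ENNReal.ofReal K := by
  rw [← Finset.mul_sum, ← ENNReal.ofReal_sum_of_nonneg hφ]
  have hpos : (M.card : ℝ≥0∞) ≠ 0 := by simpa using hM.ne_empty
  have hM' : (0 : ℝ) ≤ M.card := Nat.cast_nonneg _
  calc _ ≤ (M.card : ℝ≥0∞)⁻¹ * ENNReal.ofReal (M.card * K) :=
        mul_le_mul_right (ENNReal.ofReal_le_ofReal h) _
    _ = _ := by
        rw [ENNReal.ofReal_mul hM', ENNReal.ofReal_natCast, ← mul_assoc,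
          ENNReal.inv_mul_cancel hpos (ENNReal.natCast_ne_top _), one_mul]

theorem lyapunov_univ {c μ : ℝ} (hN : 2 ≤ N) (hc0 : 0 < c)
    (hc : ∀ j < k, c * N ≤ (Finset.univ.filter fun i => pc (x i) = j).card) :
    lyapunov g pc k δ μ x Finset.univ = 0 := by
  have h1 : unhit (Finset.univ.image x) pc k = ∅ := by
    rw [← Finset.card_eq_zero]
    have := card_filter_unhit (S := Finset.univ) (x := x) hc
    rw [Finset.compl_univ, Finset.filter_empty, Finset.card_empty, Nat.cast_zero] at this
    by_contra h
    have h2 : (0 : ℝ) < (unhit (Finset.univ.image x) pc k).card := by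
      exact_mod_cast Nat.pos_of_ne_zero h
    have h3 : (0 : ℝ) < N := by exact_mod_cast (by omega : 0 < N)
    exact absurd this (not_le.2 (by positivity))
  have h2 : ¬ Active (Finset.univ.image x) (Finset.univ.image x) g := by
    rintro ⟨p, hp, z, hz⟩
    rcases (mem_oppGaps.1 hp).1.2.2.2 z hz.1 with h | h
    · exact absurd hz.2.1 h.not_gt
    · exact absurd hz.2.2 h.not_gt
  rw [lyapunov, defect, h1, if_neg h2]
  simp

open Classical in
/-- Main estimate for a fixed pool. -/
theorem Pool.le_toOuterMeasure_run (hQ : Pool (Finset.univ.image x) g pc k δ) (hN : 2 ≤ N)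
    (hx : Function.Injective x) (hNH : N ≤ H) {c : ℝ} (hc0 : 0 < c)
    (hc : ∀ j < k, c * N ≤ (Finset.univ.filter fun i => pc (x i) = j).card) (t : ℕ) :
    ENNReal.ofReal (1 - (2 * k + 1) * Real.exp (c / 2 * (k * maxCost δ - t)))
      ≤ (run cr H g x t).toOuterMeasure {S | ZeroTrainingError H g x S} := by
  set μ := c / 2 with hμ
  have hμ0 : 0 < μ := by positivity
  -- Sets that lack an initial point do not occur in the run; the value `⊤` makes the drift
  -- inequality trivial there.
  let W : Finset (Fin N) → ℝ≥0∞ := fun S =>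
    if initialSet x ⊆ S then ENNReal.ofReal (2 * lyapunov g pc k δ μ x S) else ⊤
  have hW : ∀ S, initialSet x ⊆ S → W S = ENNReal.ofReal (2 * lyapunov g pc k δ μ x S) :=
    fun S hS => if_pos hS
  have hdrift : ∀ S, ∑' T, step cr H g x S T * W T ≤ ENNReal.ofReal (Real.exp (-μ)) * W S := by
    intro S
    by_cases hS : initialSet x ⊆ S
    swap
    · have : ENNReal.ofReal (Real.exp (-μ)) ≠ 0 := by
        simpa using Real.exp_pos (-μ)
      simp only [W, if_neg hS, ENNReal.mul_top this, le_top]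
    have hS' : ∀ i, initialSet x ⊆ insert i S := fun i => hS.trans (Finset.subset_insert _ _)
    by_cases hM : (maximizers cr H g x S).Nonempty
    · rw [tsum_step hM, hW S hS, ← ENNReal.ofReal_mul (Real.exp_nonneg _)]
      simp_rw [hW _ (hS' _)]
      refine average_le hM (fun i _ => mul_nonneg two_pos.le lyapunov_nonneg) ?_
      rw [← Finset.mul_sum]
      suffices h : ∑ i ∈ maximizers cr H g x S, lyapunov g pc k δ μ x (insert i S)
          ≤ (maximizers cr H g x S).card * (Real.exp (-μ) * lyapunov g pc k δ μ x S) by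
        linarith
      by_cases hact : Active (Finset.univ.image x) (S.image x) g
      · rw [← nsmul_eq_mul, ← Finset.sum_const]
        exact Finset.sum_le_sum fun i hi =>
          hQ.lyapunov_insert_of_active hN hx hNH hS hact hμ0.le hi
      · rw [hQ.maximizers_eq_compl hN hx hNH hS hact]
        exact hQ.sum_lyapunov_of_not_active hN hx hS hact hμ0.le le_rfl hc
    -- With everything labeled the chain stands still, so the contraction can hold only because `W`
    -- vanishes there.
    · have hu : S = Finset.univ := by
        refine Finset.eq_univ_iff_forall.2 fun i => ?_
        by_contra hi
        exact hM (maximizers_nonempty hi)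
      have h0 : W S = 0 := by
        rw [hW S hS, hu, lyapunov_univ hN hc0 hc]
        simp
      rw [step, dif_neg hM]
      refine le_of_eq_of_le ?_ zero_le
      rw [ENNReal.tsum_eq_zero]
      intro T
      rw [PMF.pure_apply]
      split_ifs with hT
      · rw [hT, h0, mul_zero]
      · rw [zero_mul]
  refine ofReal_le_toOuterMeasure _ _ W ?_ (by positivity)
    ((tsum_run_le W _ hdrift t).trans ?_)
  · intro S hS
    by_cases hSi : initialSet x ⊆ S
    swap
    · simp only [W, if_neg hSi, le_top]
    rw [hW S hSi, ENNReal.one_le_ofReal]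
    -- A failure leaves a pending bisection or a piece without a label. As the potential is
    -- nonnegative, `W` is then at least `1`, as Markov's inequality requires.
    have hd : 1 / 2 ≤ defect g pc k x S := by
      unfold defect
      split_ifs with hact
      · have : (0 : ℝ) ≤ (unhit (S.image x) pc k).card := Nat.cast_nonneg _
        linarith
      · have hne : (unhit (S.image x) pc k).Nonempty := by
          by_contra hne
          exact hS (hQ.zeroTrainingError hN hx hNH hSi hact (Finset.not_nonempty_iff_eq_empty.1 hne))
        have : (1 : ℝ) ≤ (unhit (S.image x) pc k).card := by exact_mod_cast hne.card_pos
        linarith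
    have he : 1 ≤ Real.exp (μ * potential (Finset.univ.image x) (S.image x) g k δ) :=
      Real.one_le_exp (mul_nonneg hμ0.le (hQ.potential_nonneg image_subset_pool))
    unfold lyapunov
    nlinarith
  · rw [hW _ subset_rfl, ← ENNReal.ofReal_pow (Real.exp_nonneg _),
      ← ENNReal.ofReal_mul (by positivity)]
    refine ENNReal.ofReal_le_ofReal ?_
    have h1 := hQ.potential_le (A := (initialSet x).image x) image_subset_pool
    have h2 : Real.exp (μ * potential (Finset.univ.image x) ((initialSet x).image x) g k δ)
        ≤ Real.exp (μ * (k * maxCost δ)) := by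
      rw [Real.exp_le_exp]
      exact mul_le_mul_of_nonneg_left h1 hμ0.le
    have h3 := mul_le_mul (defect_le g pc k x (initialSet x)) h2 (Real.exp_nonneg _)
      (by positivity)
    rw [← Real.exp_nat_mul, mul_sub, sub_eq_add_neg, Real.exp_add]
    unfold lyapunov
    have h4 : Real.exp (t * -μ) = Real.exp (-(μ * t)) := by ring_nf
    rw [h4]
    have h5 := Real.exp_pos (-(μ * t))
    nlinarith

end

/-! ### Random pools: separation and number of points per piece. -/

open MeasureTheory in
/-- The uniform distribution on `[0,1]`. -/
def unif : Measure ℝ := volume.restrict (Set.Icc (0 : ℝ) 1)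

open MeasureTheory in
/-- The distribution of `N` independent uniform points. -/
def pool (N : ℕ) : Measure (Fin N → ℝ) := Measure.pi fun _ => unif

instance : MeasureTheory.IsProbabilityMeasure unif := ⟨by simp [unif]⟩

instance (N : ℕ) : MeasureTheory.IsProbabilityMeasure (pool N) := by
  unfold pool
  infer_instance

theorem pool_eval {N : ℕ} (i : Fin N) {s : Set ℝ} (hs : MeasurableSet s) :
    pool N {x | x i ∈ s} = unif s :=
  (MeasureTheory.measurePreserving_eval (fun _ : Fin N => unif) i).measure_preimage
    hs.nullMeasurableSet

theorem pool_close {N : ℕ} {i j : Fin N} (hij : i ≠ j) {δ : ℝ} :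
    pool N {x | |x i - x j| < δ} ≤ ENNReal.ofReal (2 * δ) := by
  have hmeas : ∀ i : Fin N, Measurable fun x : Fin N → ℝ => x i := fun i => measurable_pi_apply i
  have hind : ProbabilityTheory.IndepFun (fun x : Fin N → ℝ => x i) (fun x => x j) (pool N) :=
    (ProbabilityTheory.iIndepFun_pi (μ := fun _ : Fin N => unif) (X := fun _ => id)
      fun _ => aemeasurable_id).indepFun hij
  rw [ProbabilityTheory.indepFun_iff_map_prod_eq_prod_map_map (hmeas i).aemeasurable
    (hmeas j).aemeasurable] at hind
  have hmap : ∀ i : Fin N, (pool N).map (fun x => x i) = unif := fun i =>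
    (MeasureTheory.measurePreserving_eval (fun _ : Fin N => unif) i).map_eq
  rw [hmap, hmap] at hind
  have hs : MeasurableSet {p : ℝ × ℝ | |p.1 - p.2| < δ} :=
    measurableSet_lt (by fun_prop) measurable_const
  have : pool N {x | |x i - x j| < δ} = (unif.prod unif) {p | |p.1 - p.2| < δ} := by
    rw [← hind, MeasureTheory.Measure.map_apply ((hmeas i).prodMk (hmeas j)) hs]
    rfl
  rw [this, MeasureTheory.Measure.prod_apply hs]
  calc ∫⁻ s, unif (Prod.mk s ⁻¹' {p : ℝ × ℝ | |p.1 - p.2| < δ}) ∂unif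
      ≤ ∫⁻ _, ENNReal.ofReal (2 * δ) ∂unif := by
        refine MeasureTheory.lintegral_mono fun s => ?_
        refine (MeasureTheory.Measure.restrict_apply_le _ _).trans ?_
        have : Prod.mk s ⁻¹' {p : ℝ × ℝ | |p.1 - p.2| < δ} = Metric.ball s δ := by
          ext z
          simp [Metric.mem_ball, Real.dist_eq, abs_sub_comm]
        rw [this, Real.volume_ball]
    _ = ENNReal.ofReal (2 * δ) := by simp

/-- Lower tail bound for the number of points in a set of probability at least `2c`. -/
theorem pool_few {N : ℕ} {J : Set ℝ} [DecidablePred (· ∈ J)] (hJ : MeasurableSet J) {c : ℝ}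
    (hc : 2 * c ≤ unif.real J) :
    pool N {x | ((Finset.univ.filter fun i => x i ∈ J).card : ℝ) < c * N}
      ≤ ENNReal.ofReal (Real.exp (-(c * N / 4))) := by
  -- A Chernoff bound with base `1 / 2`: the product of the `h (x i)` is `2` to the minus number of
  -- hits, and each factor has mean at most `1 - c ≤ exp (-c)`.
  let h : ℝ → ℝ := fun z => if z ∈ J then 1 / 2 else 1
  have hh : h = fun z => 1 - J.indicator (fun _ => 1 / 2) z := by
    funext z
    by_cases hz : z ∈ J
    · simp [h, hz]
      norm_num
    · simp [h, hz]
  have hint : MeasureTheory.Integrable h unif := by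
    rw [hh]
    exact (MeasureTheory.integrable_const _).sub
      ((MeasureTheory.integrable_const _).indicator hJ)
  have hval : ∫ z, h z ∂unif ≤ Real.exp (-c) := by
    rw [hh, MeasureTheory.integral_sub (MeasureTheory.integrable_const _)
      ((MeasureTheory.integrable_const _).indicator hJ),
      MeasureTheory.integral_indicator_const _ hJ]
    simp only [MeasureTheory.integral_const, MeasureTheory.probReal_univ, smul_eq_mul, one_mul]
    linarith [Real.add_one_le_exp (-c)]
  have hval0 : 0 ≤ ∫ z, h z ∂unif := MeasureTheory.integral_nonneg fun z => by
    simp only [h]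
    split_ifs <;> norm_num
  have hprod : ∀ x : Fin N → ℝ, ∏ i, h (x i)
      = (1 / 2 : ℝ) ^ (Finset.univ.filter fun i => x i ∈ J).card := by
    intro x
    rw [Finset.prod_ite, Finset.prod_const, Finset.prod_const_one, mul_one]
  have hE : ∫ x, ∏ i, h (x i) ∂(pool N) ≤ Real.exp (-(c * N)) := by
    rw [pool, MeasureTheory.integral_fintype_prod_eq_pow, Fintype.card_fin]
    calc (∫ z, h z ∂unif) ^ N ≤ Real.exp (-c) ^ N := pow_le_pow_left₀ hval0 hval N
      _ = _ := by rw [← Real.exp_nat_mul]; ring_nf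
  -- As `log 2 < 3 / 4`, fewer than `c * N` hits push the product above this threshold; the ratio to
  -- the mean bound leaves `exp (-(c * N / 4))`.
  have hmarkov := MeasureTheory.mul_meas_ge_le_integral_of_nonneg (μ := pool N)
    (f := fun x => ∏ i, h (x i)) (Filter.Eventually.of_forall fun x => by
      simp only [hprod]; positivity)
    (MeasureTheory.Integrable.fintype_prod fun _ => hint) (Real.exp (-(3 / 4 * (c * N))))
  have hsub : {x : Fin N → ℝ | ((Finset.univ.filter fun i => x i ∈ J).card : ℝ) < c * N}
      ⊆ {x | Real.exp (-(3 / 4 * (c * N))) ≤ ∏ i, h (x i)} := by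
    intro x hx
    simp only [Set.mem_ofPred_eq] at hx ⊢
    rw [hprod, ← Real.exp_log (by norm_num : (0 : ℝ) < 1 / 2), ← Real.exp_nat_mul,
      Real.exp_le_exp, one_div, Real.log_inv]
    have := Real.log_two_lt_d9
    have : (0 : ℝ) ≤ (Finset.univ.filter fun i => x i ∈ J).card := Nat.cast_nonneg _
    nlinarith
  refine (MeasureTheory.measure_mono hsub).trans ?_
  rw [← MeasureTheory.ofReal_measureReal (h := MeasureTheory.measure_ne_top _ _)]
  refine ENNReal.ofReal_le_ofReal ?_
  have h1 := hmarkov.trans hE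
  rw [← le_div_iff₀' (Real.exp_pos _), ← Real.exp_sub] at h1
  refine h1.trans_eq ?_
  ring_nf

/-- Lower bound for an integral whose integrand is bounded below off a small set. -/
theorem le_lintegral_of_bad {α : Type*} [MeasurableSpace α] {P : MeasureTheory.Measure α}
    [MeasureTheory.IsProbabilityMeasure P] {f : α → ℝ≥0∞} {B : Set α} {ε β : ℝ} (hβ : 0 ≤ β)
    (hε : 0 ≤ ε) (hB : P B ≤ ENNReal.ofReal β) (hf : ∀ x ∉ B, ENNReal.ofReal (1 - ε) ≤ f x) :
    ENNReal.ofReal (1 - (ε + β)) ≤ ∫⁻ x, f x ∂P := by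
  -- Neither `B` nor `f` is assumed measurable, so `B` is replaced by a measurable hull of the same
  -- measure.
  set T := MeasureTheory.toMeasurable P B
  have hT : MeasurableSet T := MeasureTheory.measurableSet_toMeasurable P B
  have hPT : P T ≤ ENNReal.ofReal β := by
    rwa [MeasureTheory.measure_toMeasurable]
  have hPTc : 1 - ENNReal.ofReal β ≤ P Tᶜ := by
    rw [MeasureTheory.prob_compl_eq_one_sub hT]
    exact tsub_le_tsub_left hPT 1
  have h1 : ∫⁻ x, Tᶜ.indicator (fun _ => ENNReal.ofReal (1 - ε)) x ∂P ≤ ∫⁻ x, f x ∂P := by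
    refine MeasureTheory.lintegral_mono fun x => ?_
    by_cases hx : x ∈ T
    · simp [hx]
    · rw [Set.indicator_of_mem (by exact hx)]
      exact hf x fun hxB => hx (MeasureTheory.subset_toMeasurable P B hxB)
  rw [MeasureTheory.lintegral_indicator_const hT.compl] at h1
  refine le_trans ?_ ((mul_le_mul_right hPTc _).trans h1)
  rw [← ENNReal.ofReal_one, ← ENNReal.ofReal_sub _ hβ]
  by_cases h : 1 - ε ≤ 0
  · rw [ENNReal.ofReal_of_nonpos (by linarith)]
    exact zero_le
  · rw [← ENNReal.ofReal_mul (by linarith)]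
    refine ENNReal.ofReal_le_ofReal ?_
    nlinarith

/-- Pools with points outside `[0,1]`, on a breakpoint, or closer than `δ`. -/
def irregular (N k : ℕ) (τ : ℕ → ℝ) (δ : ℝ) : Set (Fin N → ℝ) :=
  (⋃ i, {x | x i ∈ (Set.Icc (0 : ℝ) 1)ᶜ ∪ τ '' Set.Iic k}) ∪
    ⋃ p : Fin N × Fin N, {x | p.1 ≠ p.2 ∧ |x p.1 - x p.2| < δ}

theorem pool_irregular {N k : ℕ} {τ : ℕ → ℝ} {δ : ℝ} :
    pool N (irregular N k τ δ) ≤ ENNReal.ofReal (N ^ 2 * (2 * δ)) := by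
  have hfin : (τ '' Set.Iic k).Finite := (Set.finite_Iic k).image τ
  have h1 : pool N (⋃ i, {x | x i ∈ (Set.Icc (0 : ℝ) 1)ᶜ ∪ τ '' Set.Iic k}) = 0 := by
    rw [MeasureTheory.measure_iUnion_null_iff]
    intro i
    rw [pool_eval i (measurableSet_Icc.compl.union hfin.measurableSet)]
    refine MeasureTheory.measure_union_null ?_ ?_
    · rw [unif, MeasureTheory.Measure.restrict_apply measurableSet_Icc.compl]
      simp
    · exact le_antisymm ((MeasureTheory.Measure.restrict_apply_le _ _).trans
        (hfin.measure_zero _).le) zero_le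
  have h2 : pool N (⋃ p : Fin N × Fin N, {x | p.1 ≠ p.2 ∧ |x p.1 - x p.2| < δ})
      ≤ ENNReal.ofReal (N ^ 2 * (2 * δ)) := by
    refine (MeasureTheory.measure_iUnion_fintype_le _ _).trans ?_
    have h3 : ∀ p : Fin N × Fin N, pool N {x | p.1 ≠ p.2 ∧ |x p.1 - x p.2| < δ}
        ≤ ENNReal.ofReal (2 * δ) := by
      intro p
      by_cases hp : p.1 = p.2
      · simp [hp]
      · exact (MeasureTheory.measure_mono fun x hx => hx.2).trans (pool_close hp)
    refine (Finset.sum_le_sum fun p _ => h3 p).trans ?_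
    rw [Finset.sum_const, Finset.card_univ, Fintype.card_prod, Fintype.card_fin, nsmul_eq_mul,
      ENNReal.ofReal_mul (p := (N : ℝ) ^ 2) (by positivity), ← Nat.cast_pow,
      ENNReal.ofReal_natCast, sq]
  calc _ ≤ _ := MeasureTheory.measure_union_le _ _
    _ ≤ 0 + ENNReal.ofReal (N ^ 2 * (2 * δ)) := add_le_add h1.le h2
    _ = _ := zero_add _

theorem notMem_irregular {N k : ℕ} {τ : ℕ → ℝ} {δ : ℝ} {x : Fin N → ℝ}
    (hx : x ∉ irregular N k τ δ) : (∀ i, x i ∈ Set.Icc (0 : ℝ) 1) ∧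
      (∀ i, ∀ j ≤ k, x i ≠ τ j) ∧ ∀ i j, i ≠ j → δ ≤ |x i - x j| := by
  rw [irregular, Set.mem_union, not_or, Set.mem_iUnion, Set.mem_iUnion, not_exists,
    not_exists] at hx
  obtain ⟨h1, h2⟩ := hx
  refine ⟨fun i => ?_, fun i j hj he => ?_, fun i j hij => ?_⟩
  · by_contra h
    exact h1 i (Or.inl h)
  · exact h1 i (Or.inr ⟨j, hj, he.symm⟩)
  · by_contra h
    exact h2 (i, j) ⟨hij, not_le.1 h⟩

theorem injective_of_sep {N : ℕ} {δ : ℝ} {x : Fin N → ℝ} (hδ : 0 < δ)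
    (h : ∀ i j, i ≠ j → δ ≤ |x i - x j|) : Function.Injective x := by
  intro i j hij
  by_contra hne
  have := h i j hne
  rw [hij, sub_self, abs_zero] at this
  linarith

section

variable {k : ℕ} {τ : ℕ → ℝ}

theorem tau_mono (hτ : ∀ j < k, τ j < τ (j + 1)) {i j : ℕ} (hij : i ≤ j) (hj : j ≤ k) :
    τ i ≤ τ j := by
  induction j, hij using Nat.le_induction with
  | base => exact le_rfl
  | succ j _ ih => exact (ih (by omega)).trans (hτ j (by omega)).le

theorem exists_piece {n : ℕ} {z : ℝ} (h0 : τ 0 ≤ z) (hn : z ≤ τ n) (hne : ∀ j ≤ n, z ≠ τ j) :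
    ∃ j < n, z ∈ Set.Ioo (τ j) (τ (j + 1)) := by
  induction n with
  | zero => exact absurd (le_antisymm hn h0) (hne 0 le_rfl)
  | succ n ih =>
    by_cases h : z ≤ τ n
    · obtain ⟨j, hj, hz⟩ := ih h fun j hj => hne j (by omega)
      exact ⟨j, by omega, hz⟩
    · exact ⟨n, by omega, not_le.1 h, lt_of_le_of_ne hn (hne _ le_rfl)⟩

open Classical in
/-- The index of the piece that contains `z`. -/
def pieceIndex (k : ℕ) (τ : ℕ → ℝ) (z : ℝ) : ℕ :=
  if h : ∃ j < k, z ∈ Set.Ioo (τ j) (τ (j + 1)) then h.choose else 0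

theorem piece_le_of_le (hτ : ∀ j < k, τ j < τ (j + 1)) {i j : ℕ} (hi : i < k) {z w : ℝ}
    (hz : z ∈ Set.Ioo (τ i) (τ (i + 1))) (hw : w ∈ Set.Ioo (τ j) (τ (j + 1))) (hzw : z ≤ w) :
    i ≤ j := by
  by_contra hc
  have := tau_mono hτ (show j + 1 ≤ i by omega) (by omega)
  linarith [hz.1, hw.2]

theorem pieceIndex_spec {z : ℝ} (h : ∃ j < k, z ∈ Set.Ioo (τ j) (τ (j + 1))) :
    pieceIndex k τ z < k ∧ z ∈ Set.Ioo (τ (pieceIndex k τ z)) (τ (pieceIndex k τ z + 1)) := by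
  rw [pieceIndex, dif_pos h]
  exact h.choose_spec

theorem pieceIndex_eq (hτ : ∀ j < k, τ j < τ (j + 1)) {j : ℕ} (hj : j < k) {z : ℝ}
    (hz : z ∈ Set.Ioo (τ j) (τ (j + 1))) : pieceIndex k τ z = j := by
  obtain ⟨h1, h2⟩ := pieceIndex_spec ⟨j, hj, hz⟩
  exact le_antisymm (piece_le_of_le hτ h1 h2 hz le_rfl) (piece_le_of_le hτ hj hz h2 le_rfl)

theorem pool_of_notMem_irregular {N : ℕ} {g : ℝ → ℝ} {δ : ℝ} {x : Fin N → ℝ}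
    (hδ : 0 < δ) (hδ1 : δ ≤ 1) (hτ0 : τ 0 = 0) (hτk : τ k = 1) (hτ : ∀ j < k, τ j < τ (j + 1))
    (hlab : ∀ z ∈ Set.Icc (0 : ℝ) 1, g z = 1 ∨ g z = -1)
    (hg : ∀ j < k, ∃ s : ℝ, ∀ z ∈ Set.Ioo (τ j) (τ (j + 1)), g z = s)
    (hx : x ∉ irregular N k τ δ) :
    Pool (Finset.univ.image x) g (pieceIndex k τ) k δ := by
  obtain ⟨h1, h2, h3⟩ := notMem_irregular hx
  have hp : ∀ z ∈ Finset.univ.image x, ∃ j < k, z ∈ Set.Ioo (τ j) (τ (j + 1)) := by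
    intro z hz
    obtain ⟨i, -, rfl⟩ := Finset.mem_image.1 hz
    exact exists_piece (hτ0 ▸ (h1 i).1) (hτk ▸ (h1 i).2) (h2 i)
  have hu : ∀ z ∈ Finset.univ.image x, z ∈ Set.Icc (0 : ℝ) 1 := by
    intro z hz
    obtain ⟨i, -, rfl⟩ := Finset.mem_image.1 hz
    exact h1 i
  refine ⟨hδ, hδ1, ?_, hu, fun z hz => hlab z (hu z hz), fun z hz => (pieceIndex_spec (hp z hz)).1,
    ?_, ?_⟩
  · intro z hz w hw hzw
    obtain ⟨i, -, rfl⟩ := Finset.mem_image.1 hz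
    obtain ⟨j, -, rfl⟩ := Finset.mem_image.1 hw
    have := h3 j i fun h => hzw.ne (by rw [h])
    rwa [abs_of_pos (by linarith)] at this
  · intro z hz w hw hzw
    obtain ⟨hi, hz⟩ := pieceIndex_spec (hp z hz)
    exact piece_le_of_le hτ hi hz (pieceIndex_spec (hp w hw)).2 hzw
  · intro z hz w hw hzw
    obtain ⟨hi, hz⟩ := pieceIndex_spec (hp z hz)
    have hw := (pieceIndex_spec (hp w hw)).2
    rw [← hzw] at hw
    obtain ⟨s, hs⟩ := hg _ hi
    rw [hs z hz, hs w hw]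

open Classical in
/-- Pools in which some piece contains few points. -/
def sparse (N k : ℕ) (τ : ℕ → ℝ) (c : ℝ) : Set (Fin N → ℝ) :=
  ⋃ j : Fin k, {x | ((Finset.univ.filter fun i => x i ∈ Set.Ioo (τ j) (τ (j + 1))).card : ℝ)
    < c * N}

theorem unif_real_piece (hτ0 : τ 0 = 0) (hτk : τ k = 1) (hτ : ∀ j < k, τ j < τ (j + 1)) {j : ℕ}
    (hj : j < k) : unif.real (Set.Ioo (τ j) (τ (j + 1))) = τ (j + 1) - τ j := by
  have h0 := tau_mono hτ (Nat.zero_le j) hj.le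
  have h1 := tau_mono hτ (show j + 1 ≤ k by omega) le_rfl
  have hsub : Set.Ioo (τ j) (τ (j + 1)) ⊆ Set.Icc (0 : ℝ) 1 := fun z hz =>
    ⟨by linarith [hz.1], by linarith [hz.2]⟩
  rw [MeasureTheory.Measure.real, unif, MeasureTheory.Measure.restrict_apply measurableSet_Ioo,
    Set.inter_eq_left.2 hsub, Real.volume_Ioo,
    ENNReal.toReal_ofReal (by linarith [hτ j hj])]

theorem pool_sparse {N : ℕ} {c : ℝ} (hτ0 : τ 0 = 0) (hτk : τ k = 1)
    (hτ : ∀ j < k, τ j < τ (j + 1)) (hc : ∀ j < k, 2 * c ≤ τ (j + 1) - τ j) :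
    pool N (sparse N k τ c) ≤ ENNReal.ofReal (k * Real.exp (-(c * N / 4))) := by
  refine (MeasureTheory.measure_iUnion_fintype_le _ _).trans ?_
  refine (Finset.sum_le_sum fun (j : Fin k) _ => pool_few measurableSet_Ioo
    ((hc j (Fin.is_lt j)).trans_eq (unif_real_piece hτ0 hτk hτ (Fin.is_lt j)).symm)).trans ?_
  rw [Finset.sum_const, Finset.card_univ, Fintype.card_fin, nsmul_eq_mul,
    ENNReal.ofReal_mul (by positivity), ENNReal.ofReal_natCast]

theorem le_card_piece_of_notMem_sparse {N : ℕ} {c : ℝ} {x : Fin N → ℝ}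
    (hτ : ∀ j < k, τ j < τ (j + 1)) (hx : x ∉ sparse N k τ c) :
    ∀ j < k, c * N ≤ (Finset.univ.filter fun i => pieceIndex k τ (x i) = j).card := by
  classical
  intro j hj
  rw [sparse, Set.mem_iUnion, not_exists] at hx
  refine (not_lt.1 (hx ⟨j, hj⟩)).trans ?_
  exact_mod_cast Finset.card_le_card fun i hi => by
    rw [Finset.mem_filter] at hi ⊢
    exact ⟨hi.1, pieceIndex_eq hτ hj hi.2⟩

end

/-! ### Combination of the error terms and choice of constants. -/

/-- The quantitative form of the result, with all error terms. -/
theorem le_successProb {N H k : ℕ} {g : ℝ → ℝ} {cr : Criterion} {c₁ c₂ δ : ℝ} (hN : 2 ≤ N)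
    (hk : 1 ≤ k) (hNH : N ≤ H) (hc₁ : 0 < c₁) (hg : PiecewiseConstant k c₁ c₂ g) (hδ : 0 < δ)
    (hδ1 : δ ≤ 1) (t : ℕ) :
    ENNReal.ofReal (1 - ((2 * k + 1) * Real.exp (c₁ / (4 * k) * (k * maxCost δ - t))
      + (N ^ 2 * (2 * δ) + k * Real.exp (-(c₁ * N / (8 * k)))))) ≤ successProb N cr H g t := by
  obtain ⟨hlab, τ, hτ0, hτk, hτ⟩ := hg
  have hk0 : (0 : ℝ) < k := by exact_mod_cast hk
  have hmono : ∀ j < k, τ j < τ (j + 1) := fun j hj => (hτ j hj).1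
  set c := c₁ / (2 * k) with hc
  have hc0 : 0 < c := by positivity
  refine le_lintegral_of_bad (P := pool N) (B := irregular N k τ δ ∪ sparse N k τ c)
    (by positivity) (by positivity) ?_ fun x hx => ?_
  · refine (MeasureTheory.measure_union_le _ _).trans ?_
    rw [ENNReal.ofReal_add (by positivity) (by positivity)]
    refine add_le_add (pool_irregular) ?_
    have := pool_sparse (N := N) hτ0 hτk hmono fun j hj => by
      have : 2 * c = c₁ / k := by rw [hc]; field_simp
      rw [this]
      exact (hτ j hj).2.1
    refine this.trans_eq ?_
    have : c * N / 4 = c₁ * N / (8 * k) := by rw [hc]; field_simp; norm_num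
    rw [this]
  · rw [Set.mem_union, not_or] at hx
    have hQ := pool_of_notMem_irregular hδ hδ1 hτ0 hτk hmono hlab
      (fun j hj => (hτ j hj).2.2.2) hx.1
    have hinj := injective_of_sep hδ (notMem_irregular hx.1).2.2
    have := hQ.le_toOuterMeasure_run (cr := cr) hN hinj hNH hc0
      (le_card_piece_of_notMem_sparse hmono hx.2) t
    have he : c / 2 = c₁ / (4 * k) := by rw [hc]; field_simp; norm_num
    rwa [he] at this

/-- With a budget of at least `N` labels everything gets labeled, and it suffices that the points
are distinct and lie in `[0, 1]`. Breakpoints play no role, so `irregular` is used with `0` pieces,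
which adds only the null event that some point is `0`. -/
theorem le_successProb_of_le {N H k : ℕ} {g : ℝ → ℝ} {cr : Criterion} {c₁ c₂ δ : ℝ} (hN : 2 ≤ N)
    (hNH : N ≤ H) (hg : PiecewiseConstant k c₁ c₂ g) (hδ : 0 < δ) {t : ℕ} (ht : N ≤ t + 2) :
    ENNReal.ofReal (1 - (0 + N ^ 2 * (2 * δ))) ≤ successProb N cr H g t := by
  refine le_lintegral_of_bad (P := pool N) (B := irregular N 0 (fun _ => 0) δ)
    (by positivity) le_rfl (pool_irregular) fun x hx => ?_
  obtain ⟨h1, -, h3⟩ := notMem_irregular hx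
  rw [toOuterMeasure_run_of_le hN (injective_of_sep hδ h3) hNH (fun i => hg.1 _ (h1 i)) ht]
  simp

end MaxiMin

end

theorem mainTheorem2 (c₁ c₂ : ℝ) (hc₁ : 0 < c₁) (hc₂ : c₁ ≤ c₂) (a : ℝ) (ha : 0 < a) :
    ∃ C : ℝ, 0 < C ∧
      ∀ (N k H : ℕ) (g : ℝ → ℝ) (cr : MaxiMin.Criterion),
        2 ≤ N → 1 ≤ k → N ≤ H → MaxiMin.PiecewiseConstant k c₁ c₂ g →
        ∀ t : ℕ, C * k * Real.log N ≤ (t : ℝ) + 2 →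
          ENNReal.ofReal (1 - (N : ℝ) ^ (-a)) ≤ MaxiMin.successProb N cr H g t := by
  -- The part `34 + 8 * a` pays for `maxCost` at `δ = N ^ (-(a + 4))`, a further `4` absorbs the two
  -- initial labels, and the last term supplies the exponent `a + 5` after multiplication by the
  -- rate `c₁ / (4 * k)`.
  refine ⟨38 + 8 * a + 8 / c₁ * (a + 5), by positivity, ?_⟩
  intro N k H g cr hN hk hNH hg t ht
  have hN2 : (2 : ℝ) ≤ N := by exact_mod_cast hN
  have hN0 : (0 : ℝ) < N := by linarith
  have hk1 : (1 : ℝ) ≤ k := by exact_mod_cast hk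
  have hlog : 1 / 2 ≤ Real.log N := by
    have := Real.log_two_gt_d9
    have := Real.log_le_log (by norm_num) hN2
    linarith
  have hδ : 0 < (N : ℝ) ^ (-(a + 4)) := Real.rpow_pos_of_pos hN0 _
  -- The separation error is `2 * η`, and the sparse pieces and the run contribute at most `η` each;
  -- `4 * η ≤ N ^ (-a)` since `N ≥ 2`.
  set η : ℝ := (N : ℝ) ^ (-(a + 2)) with hη
  have hη0 : 0 < η := Real.rpow_pos_of_pos hN0 _
  have hsplit : ∀ b : ℝ, Real.exp (-(b * Real.log N)) = (N : ℝ) ^ (-b) := by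
    intro b
    rw [Real.rpow_def_of_pos hN0]
    ring_nf
  have hηa : 4 * η ≤ (N : ℝ) ^ (-a) := by
    have : (N : ℝ) ^ (-a) = (N : ℝ) ^ 2 * η := by
      rw [hη, ← Real.rpow_natCast, ← Real.rpow_add hN0]
      congr 1
      push_cast
      ring
    rw [this]
    exact mul_le_mul_of_nonneg_right (by nlinarith) hη0.le
  have hsep : (N : ℝ) ^ 2 * (2 * (N : ℝ) ^ (-(a + 4))) = 2 * η := by
    have : η = (N : ℝ) ^ 2 * (N : ℝ) ^ (-(a + 4)) := by
      rw [hη, ← Real.rpow_natCast, ← Real.rpow_add hN0]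
      congr 1
      push_cast
      ring
    rw [this]
    ring
  -- In the remaining case the hypothesis on `t` forces `C * k * log N < N`. This gives `k ≤ N` and
  -- makes the expected number of points per piece large compared with `log N`.
  by_cases hNt : N ≤ t + 2
  · refine le_trans (ENNReal.ofReal_le_ofReal ?_)
      (MaxiMin.le_successProb_of_le (cr := cr) hN hNH hg hδ hNt)
    rw [hsep]
    linarith
  have hNt' : (t : ℝ) + 2 < N := by exact_mod_cast not_le.1 hNt
  set C := 38 + 8 * a + 8 / c₁ * (a + 5) with hC
  have hc8 : 0 < 8 / c₁ * (a + 5) := by positivity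
  have hCN : C * k * Real.log N < N := ht.trans_lt hNt'
  have hkN : (k : ℝ) ≤ N := by
    have h1 : 1 ≤ C * Real.log N := by nlinarith
    nlinarith
  refine le_trans (ENNReal.ofReal_le_ofReal ?_)
    (MaxiMin.le_successProb (cr := cr) hN hk hNH hc₁ hg hδ
      (Real.rpow_le_one_of_one_le_of_nonpos (by linarith) (by linarith)) t)
  have hfew : k * Real.exp (-(c₁ * N / (8 * k))) ≤ η := by
    have h1 : (a + 3) * Real.log N ≤ c₁ * N / (8 * k) := by
      rw [le_div_iff₀ (by linarith)]
      have h2 : c₁ * (8 / c₁ * (a + 5)) = 8 * (a + 5) := by field_simp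
      have h3 : 8 * (a + 5) ≤ c₁ * C := by
        rw [← h2]
        exact mul_le_mul_of_nonneg_left (by linarith) hc₁.le
      have h4 : 0 ≤ (k : ℝ) * Real.log N := by positivity
      nlinarith
    calc k * Real.exp (-(c₁ * N / (8 * k))) ≤ N * Real.exp (-((a + 3) * Real.log N)) :=
          mul_le_mul hkN (Real.exp_le_exp.2 (by linarith)) (Real.exp_nonneg _) hN0.le
      _ = η := by
          rw [hsplit, hη]
          nth_rewrite 1 [← Real.rpow_one (N : ℝ)]
          rw [← Real.rpow_add hN0]
          congr 1
          ring
  have hrun : (2 * k + 1) * Real.exp (c₁ / (4 * k) *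
      (k * MaxiMin.maxCost ((N : ℝ) ^ (-(a + 4))) - t)) ≤ η := by
    have hm : MaxiMin.maxCost ((N : ℝ) ^ (-(a + 4))) ≤ (34 + 8 * a) * Real.log N := by
      rw [MaxiMin.maxCost, Real.log_inv, Real.log_rpow hN0]
      linarith
    have h1 : c₁ / (4 * k) * (k * MaxiMin.maxCost ((N : ℝ) ^ (-(a + 4))) - t)
        ≤ -((a + 5) * Real.log N) := by
      rw [div_mul_eq_mul_div, div_le_iff₀ (by linarith)]
      have h2 : (k : ℝ) * MaxiMin.maxCost ((N : ℝ) ^ (-(a + 4))) - t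
          ≤ -(8 / c₁ * (a + 5) * (k * Real.log N)) := by
        have h3 := mul_le_mul_of_nonneg_left hm (by linarith : (0 : ℝ) ≤ k)
        have h4 : 1 / 2 ≤ k * Real.log N := by nlinarith
        have h5 : C * k * Real.log N = (34 + 8 * a) * (k * Real.log N)
            + 4 * (k * Real.log N) + 8 / c₁ * (a + 5) * (k * Real.log N) := by
          rw [hC]
          ring
        nlinarith
      have h6 : 0 ≤ (a + 5) * (k * Real.log N) := by positivity
      calc _ ≤ c₁ * -(8 / c₁ * (a + 5) * (k * Real.log N)) :=
            mul_le_mul_of_nonneg_left h2 hc₁.le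
        _ = -(8 * ((a + 5) * (k * Real.log N))) := by field_simp
        _ ≤ _ := by linarith
    have h2 : (2 * k + 1 : ℝ) ≤ N ^ 3 := by nlinarith [sq_nonneg (N : ℝ), mul_pos hN0 hN0]
    calc _ ≤ (N : ℝ) ^ 3 * Real.exp (-((a + 5) * Real.log N)) :=
          mul_le_mul h2 (Real.exp_le_exp.2 h1) (Real.exp_nonneg _) (by positivity)
      _ = η := by
          rw [hsplit, hη, ← Real.rpow_natCast, ← Real.rpow_add hN0]
          congr 1
          push_cast
          ring
  rw [hsep]
  linarith
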